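/- Let $N\ge 0$ and let $B$ be the group of invertible upper triangular complex $N\times N$ matrices, acting on complex $N\times N$ matrices by conjugation. For an involution $\pi\in S_N$ (that is, $\pi^2=1$; fixed points are allowed) let $\pi_<$ be the strictly upper triangular part of its permutation matrix, with entry $1$ at $(i,\pi(i))$ whenever $i<\pi(i)$ and $0$ elsewhere, and put $\operatorname{rank}\pi_{[ij]}:=\#\{(a,b): i\le a<b\le j,\ \pi(a)=b\}$. (i) For all involutions $\pi,\rho\in S_N$, $$\overline{B\cdot\pi_<}\supseteq B\cdot\rho_<\iff \operatorname{rank}\pi_{[ij]}\ge\operatorname{rank}\rho_{[ij]}\ \text{ for all } i<j,$$ where the closure may be taken either in the Zariski or in the Euclidean topology. (ii) Order the involutions in $S_N$ by $\pi\ge\rho\iff\overline{B\cdot\pi_<}\supseteq B\cdot\rho_<$. Draw $\pi$ in the upper half plane with an arch from $i$ to $\pi(i)$ for each $i<\pi(i)$ and a vertical half-line from each fixed point. Two arches $(a,b)$, $(c,d)$ cross if $a<c<b<d$ or $c<a<d<b$; an arch $(a,b)$ crosses the half-line at $h$ if $a<h<b$; half-lines do not cross each other. Say that two non-crossing curves (arches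 or half-lines) are adjacent if there is no third curve that crosses neither of them and has them on different sides (below and not below, for an arch; left and right, for a half-line) (this expresses that they border a common region in some drawing in which any two curves cross at most once). Then $\pi$ covers $\rho$ if and only if $\rho$ arises from $\pi$ by one of the following moves, which leave all other curves unchanged: 1. for positions $a<b<c<d$, two adjacent arches, $(a,b),(c,d)$ or $(a,d),(b,c)$, are replaced by the arches $(a,c),(b,d)$; 2. an arch $(a,b)$ and an adjacent half-line at $h$ are replaced, if $h<a$, by the arch $(h,b)$ and a half-line at $a$, and, if $h>b$, by the arch $(a,h)$ and a half-line at $b$; 3. an arch $(a,b)$ that crosses all the half-lines and is not below another arch (that is, there is no arch $(x,y)$ with $x<a<b<y$) is replaced by half-lines at $a$ and $b$. -/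

import Mathlib

namespace OrbitPoset

/-! ### Matrices, orbits and closures -/

/-- `π_<`: the strictly upper triangular part of the permutation matrix of `π`. -/
def upperPart {N : ℕ} (π : Equiv.Perm (Fin N)) : Matrix (Fin N) (Fin N) ℂ :=
  Matrix.of fun i j => if i < j ∧ π i = j then 1 else 0

/-- The orbit `B · M`, where the group `B` of invertible upper triangular complex matrices acts by
conjugation. -/
def borelOrbit {N : ℕ} (M : Matrix (Fin N) (Fin N) ℂ) : Set (Matrix (Fin N) (Fin N) ℂ) :=
  {X | ∃ b : GL (Fin N) ℂ, (b : Matrix (Fin N) (Fin N) ℂ).BlockTriangular id ∧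
    X = (b : Matrix (Fin N) (Fin N) ℂ) * M * ((b⁻¹ : GL (Fin N) ℂ) : Matrix (Fin N) (Fin N) ℂ)}

/-- The Zariski closure of a set of complex matrices: the common zeros of all polynomials in the
matrix entries that vanish on the set. -/
def zariskiClosure {N : ℕ} (S : Set (Matrix (Fin N) (Fin N) ℂ)) :
    Set (Matrix (Fin N) (Fin N) ℂ) :=
  {X | ∀ f : MvPolynomial (Fin N × Fin N) ℂ,
    (∀ Y ∈ S, MvPolynomial.eval (fun p : Fin N × Fin N => Y p.1 p.2) f = 0) →
      MvPolynomial.eval (fun p : Fin N × Fin N => X p.1 p.2) f = 0}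

/-- `rank π_[ij]`: the number of complete arches of `π` between the positions `i` and `j`. -/
def archRank {N : ℕ} (π : Equiv.Perm (Fin N)) (i j : Fin N) : ℕ :=
  (Finset.univ.filter fun p : Fin N × Fin N =>
    i ≤ p.1 ∧ p.1 < p.2 ∧ p.2 ≤ j ∧ π p.1 = p.2).card

/-! ### The poset of orbits -/

/-- `π ≥ ρ`: the closure of `B · π_<` contains `B · ρ_<`. -/
def OrbitGE {N : ℕ} (π ρ : Equiv.Perm (Fin N)) : Prop :=
  borelOrbit (upperPart ρ) ⊆ zariskiClosure (borelOrbit (upperPart π))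

/-- `π > ρ` in the order of orbit closures. -/
def OrbitGT {N : ℕ} (π ρ : Equiv.Perm (Fin N)) : Prop :=
  OrbitGE π ρ ∧ ¬ OrbitGE ρ π

/-- `π` covers `ρ` in the poset of orbits, which are indexed by the involutions. -/
def OrbitCovers {N : ℕ} (π ρ : Equiv.Perm (Fin N)) : Prop :=
  OrbitGT π ρ ∧
    ∀ σ : Equiv.Perm (Fin N), Function.Involutive σ → ¬ (OrbitGT π σ ∧ OrbitGT σ ρ)

/-! ### Chord diagrams

The chord diagram of an involution `π` lives in the upper half plane. Its curves are the arches
joining `x` to `π x` for `x < π x`, and the vertical half-lines from the fixed points `x = π x`.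
A curve is named by its left end `x`, so `x ≤ π x`. A half-line counts as a curve whose right end
is at infinity, which lies to the right of all positions. -/

/-- The right end of the curve with left end `x`. -/
def rightEnd {N : ℕ} (π : Equiv.Perm (Fin N)) (x : Fin N) : WithTop (Fin N) :=
  if π x = x then ⊤ else ((π x : Fin N) : WithTop (Fin N))

/-- `x` is the left end of a curve. -/
def IsCurve {N : ℕ} (π : Equiv.Perm (Fin N)) (x : Fin N) : Prop := x ≤ π x

/-- The curves with left ends `x` and `y` cross: their ends interlace. (Two half-lines never
cross, and an arch crosses exactly the half-lines that start below it.) -/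
def Cross {N : ℕ} (π : Equiv.Perm (Fin N)) (x y : Fin N) : Prop :=
  (x < y ∧ (y : WithTop (Fin N)) < rightEnd π x ∧ rightEnd π x < rightEnd π y) ∨
    (y < x ∧ (x : WithTop (Fin N)) < rightEnd π y ∧ rightEnd π y < rightEnd π x)

/-- The position `x` lies below the arch with left end `z`, or to the right of the half-line
at `z`. -/
def Inside {N : ℕ} (π : Equiv.Perm (Fin N)) (z x : Fin N) : Prop :=
  z < x ∧ (x : WithTop (Fin N)) < rightEnd π z

/-- The curve `z` meets neither of the curves `x` and `y`, and these are on different sides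
of it. -/
def Separates {N : ℕ} (π : Equiv.Perm (Fin N)) (z x y : Fin N) : Prop :=
  ¬ Cross π z x ∧ ¬ Cross π z y ∧ ¬ (Inside π z x ↔ Inside π z y)

/-- The non-crossing curves `x` and `y` border a common region, in at least one of the drawings
of `π` in which any two curves cross at most once: no third curve separates them. -/
def BorderCommonRegion {N : ℕ} (π : Equiv.Perm (Fin N)) (x y : Fin N) : Prop :=
  ∀ z, IsCurve π z → z ≠ x → z ≠ y → ¬ Separates π z x y

/-- The arch with left end `a` borders an unbounded region, in at least one of the drawings of `π`
in which any two curves cross at most once: no other arch passes over it. -/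
def BorderUnbounded {N : ℕ} (π : Equiv.Perm (Fin N)) (a : Fin N) : Prop :=
  ∀ z, ¬ (z < a ∧ π a < π z)

/-- Two arches that do not cross, side by side or nested, but border a common region, are made to
touch, and the contact is turned into a crossing. -/
def MoveArchArch {N : ℕ} (π ρ : Equiv.Perm (Fin N)) : Prop :=
  ∃ a b c d : Fin N, a < b ∧ b < c ∧ c < d ∧
    ((π a = b ∧ π c = d ∧ BorderCommonRegion π a c) ∨
      (π a = d ∧ π b = c ∧ BorderCommonRegion π a b)) ∧
    ρ a = c ∧ ρ b = d ∧
    ∀ x, x ≠ a → x ≠ b → x ≠ c → x ≠ d → ρ x = π x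

/-- An arch from `a` to `b` and a half-line at `h`, to its left or to its right, that do not cross
but border a common region, are made to touch, and the contact is turned into a crossing. -/
def MoveArchHalfLine {N : ℕ} (π ρ : Equiv.Perm (Fin N)) : Prop :=
  ∃ a b h : Fin N, a < b ∧ π a = b ∧ π h = h ∧ BorderCommonRegion π a h ∧
    ((h < a ∧ ρ h = b ∧ ρ a = a) ∨ (b < h ∧ ρ a = h ∧ ρ b = b)) ∧
    ∀ x, x ≠ a → x ≠ b → x ≠ h → ρ x = π x

/-- An arch from `a` to `b` that crosses all the half-lines and borders an unbounded region is
broken into two half-lines. -/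
def MoveBreak {N : ℕ} (π ρ : Equiv.Perm (Fin N)) : Prop :=
  ∃ a b : Fin N, a < b ∧ π a = b ∧ (∀ h, π h = h → Cross π a h) ∧ BorderUnbounded π a ∧
    ρ a = a ∧ ρ b = b ∧ ∀ x, x ≠ a → x ≠ b → ρ x = π x

/-- `ρ` arises from `π` by one of the three moves. -/
def Move {N : ℕ} (π ρ : Equiv.Perm (Fin N)) : Prop :=
  MoveArchArch π ρ ∨ MoveArchHalfLine π ρ ∨ MoveBreak π ρ

end OrbitPoset

namespace OrbitPoset

/-! ### Counting arches in intervals -/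

/-! Three conditions are linked in a circle: rank inequalities give a chain of moves, a chain of
moves gives an inclusion in the Euclidean closure, hence in the Zariski closure, and this gives back
the rank inequalities.

The last implication is a vanishing of minors (`intervalRank_le_of_subset_zariskiClosure`).
Conjugation by `B` cannot raise the rank of the lower left block cut out by an interval, and for
`π_<` that rank is the number of arches in the interval. Each single move is realised by a
one-parameter degeneration, written down explicitly (`mem_closure_of_move`).

The combinatorial core is `exists_move`: if `π` dominates `ρ` and `π ≠ ρ`, some move from `π` still
dominates `ρ`. Pick an arch `(i, j)` of `π` whose interval has excess, meaning that `π` has more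
arches there than `ρ`. A move loses at most one arch per interval, so it is harmless when every
losing interval has excess. If all intervals around `(i, j)` have excess, the arch may be broken
unless a curve can be made to touch it. If some interval has none, comparing two such tight
intervals by a modular identity, or a tight interval with one shorter by a position, produces a
curve whose crossing with `(i, j)` is harmless (`exists_swapAt`). Among such curves one of least
index is adjacent to the arch, since a separating curve would be a candidate of smaller index
(`exists_move_of_swapAt`).

The function `grade`, four times the crossings plus the square of the number of half-lines, rises by
exactly 4 in every move. Being bounded, it makes the search for moves terminate. It also identifies
the covers: a strict relation costs at least 4, so nothing fits strictly inside one move, and a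
chain representing a cover has only one step. -/

/-- The number of arches of `π` with both ends in the half-open interval `[x, y)`. -/
def intervalRank {N : ℕ} (π : Equiv.Perm (Fin N)) (x y : ℕ) : ℕ :=
  ∑ a : Fin N, if x ≤ a.1 ∧ a.1 < (π a).1 ∧ (π a).1 < y then 1 else 0

theorem archRank_eq_intervalRank {N : ℕ} (π : Equiv.Perm (Fin N)) (i j : Fin N) :
    archRank π i j = intervalRank π i (j + 1) := by
  unfold archRank intervalRank
  rw [← Finset.card_filter]
  symm
  refine Finset.card_bij (fun a _ => (a, π a)) ?_ ?_ ?_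
  · intro a ha
    simp only [Finset.mem_filter, Finset.mem_univ, true_and, Fin.le_def, Fin.lt_def] at ha ⊢
    exact ⟨ha.1, ha.2.1, by omega, trivial⟩
  · intro a _ b _ h
    exact (Prod.ext_iff.1 h).1
  · rintro ⟨a, b⟩ h
    simp only [Finset.mem_filter, Finset.mem_univ, true_and, Fin.le_def, Fin.lt_def] at h
    obtain ⟨h1, h2, h3, h4⟩ := h
    subst h4
    exact ⟨a, by simp; omega, rfl⟩

theorem intervalRank_eq_zero {N : ℕ} (π : Equiv.Perm (Fin N)) {x y : ℕ} (h : y ≤ x + 1) :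
    intervalRank π x y = 0 := by
  unfold intervalRank
  refine Finset.sum_eq_zero fun a _ => if_neg ?_
  omega

theorem intervalRank_of_le {N : ℕ} (π : Equiv.Perm (Fin N)) {x y : ℕ} (h : N ≤ y) :
    intervalRank π x y = intervalRank π x N := by
  unfold intervalRank
  refine Finset.sum_congr rfl fun a _ => ?_
  have := (π a).2
  congr 1
  simp only [eq_iff_iff]
  omega

theorem forall_archRank_le_iff {N : ℕ} (π ρ : Equiv.Perm (Fin N)) :
    (∀ i j : Fin N, i < j → archRank ρ i j ≤ archRank π i j) ↔
      ∀ x y, intervalRank ρ x y ≤ intervalRank π x y := by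
  constructor
  · intro h x y
    have key : ∀ y ≤ N, intervalRank ρ x y ≤ intervalRank π x y := by
      intro y hy
      by_cases hxy : y ≤ x + 1
      · rw [intervalRank_eq_zero ρ hxy]; exact Nat.zero_le _
      · have := h ⟨x, by omega⟩ ⟨y - 1, by omega⟩ (by rw [Fin.lt_def]; simp; omega)
        rw [archRank_eq_intervalRank, archRank_eq_intervalRank] at this
        simpa [Nat.sub_add_cancel (by omega : 1 ≤ y)] using this
    rcases le_total y N with hy | hy
    · exact key y hy
    · rw [intervalRank_of_le π hy, intervalRank_of_le ρ hy]
      exact key N le_rfl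
  · intro h i j _
    rw [archRank_eq_intervalRank, archRank_eq_intervalRank]
    exact h _ _

/-- Supermodularity of the number of arches: the defect counts the arches that join the two
differences. -/
theorem intervalRank_supermodular {N : ℕ} (π : Equiv.Perm (Fin N)) {u v w z : ℕ}
    (huv : u ≤ v) (hwz : w ≤ z) (hvw : v ≤ w) :
    intervalRank π u z + intervalRank π v w = intervalRank π u w + intervalRank π v z +
      ∑ a : Fin N, if u ≤ a.1 ∧ a.1 < v ∧ w ≤ (π a).1 ∧ (π a).1 < z then 1 else 0 := by
  unfold intervalRank
  rw [← Finset.sum_add_distrib, ← Finset.sum_add_distrib, ← Finset.sum_add_distrib]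
  refine Finset.sum_congr rfl fun a _ => ?_
  split_ifs <;> omega

/-- A sum over all positions, rearranged into a sum over the curves of an involution. -/
theorem sum_eq_sum_curves {N : ℕ} {π : Equiv.Perm (Fin N)} (hπ : Function.Involutive π)
    (g : Fin N → ℕ) :
    ∑ p, g p = ∑ p, ((if p.1 < (π p).1 then g p + g (π p) else 0) +
      if p.1 = (π p).1 then g p else 0) := by
  have h1 : ∑ p, (if (π p).1 < p.1 then g p else 0)
      = ∑ p, (if p.1 < (π p).1 then g (π p) else 0) := by
    rw [← Equiv.sum_comp π]
    refine Finset.sum_congr rfl fun p _ => ?_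
    rw [hπ p]
  have h2 : ∑ p, g p = ∑ p, ((if p.1 < (π p).1 then g p else 0) +
      (if p.1 = (π p).1 then g p else 0)) + ∑ p, (if (π p).1 < p.1 then g p else 0) := by
    rw [← Finset.sum_add_distrib]
    refine Finset.sum_congr rfl fun p _ => ?_
    split_ifs <;> omega
  rw [h2, h1, ← Finset.sum_add_distrib]
  refine Finset.sum_congr rfl fun p _ => ?_
  split_ifs <;> omega

/-- For overlapping intervals `[u, w)` and `[v, z)`, the positions of the overlap are counted by
where their partners lie. -/
theorem intervalRank_overlap {N : ℕ} {π : Equiv.Perm (Fin N)} (hπ : Function.Involutive π)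
    {u v w z : ℕ} (huv : u ≤ v) (hvw : v ≤ w) (hwz : w ≤ z) :
    intervalRank π u w + intervalRank π v z +
      (∑ p : Fin N, if (v ≤ p.1 ∧ p.1 < w) ∧ ((π p).1 < u ∨ z ≤ (π p).1 ∨ (π p).1 = p.1)
        then 1 else 0) =
    intervalRank π u v + intervalRank π w z + ∑ p : Fin N, if v ≤ p.1 ∧ p.1 < w then 1 else 0 := by
  rw [sum_eq_sum_curves hπ (fun p => if (v ≤ p.1 ∧ p.1 < w) ∧ _ then 1 else 0),
    sum_eq_sum_curves hπ (fun p => if v ≤ p.1 ∧ p.1 < w then 1 else 0)]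
  unfold intervalRank
  rw [← Finset.sum_add_distrib, ← Finset.sum_add_distrib, ← Finset.sum_add_distrib,
    ← Finset.sum_add_distrib]
  refine Finset.sum_congr rfl fun a _ => ?_
  simp only [hπ a]
  rcases lt_trichotomy a.1 (π a).1 with h | h | h
  · simp only [h, true_and, if_true, h.ne, or_false, if_false]
    split_ifs <;> omega
  · simp only [← h, lt_irrefl, false_and, and_false, or_true, and_true, if_false, if_true]
  · simp only [h.not_gt, h.ne', false_and, and_false, if_false]

/-! ### Excess -/

/-- `π` has more arches than `ρ` in the interval `[x, y)`. -/
def Excess {N : ℕ} (π ρ : Equiv.Perm (Fin N)) (x y : ℕ) : Prop :=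
  intervalRank ρ x y < intervalRank π x y

/-- In the mixed second difference of the counts only an arch joining the two extreme positions
survives. The counts therefore determine the involution. -/
theorem intervalRank_corner {N : ℕ} (π : Equiv.Perm (Fin N)) (i j : Fin N) (h : i < j) :
    intervalRank π i (j + 1) + intervalRank π (i + 1) j =
      intervalRank π i j + intervalRank π (i + 1) (j + 1) + if π i = j then 1 else 0 := by
  rw [Fin.lt_def] at h
  rw [intervalRank_supermodular π (u := i) (v := i + 1) (w := j) (z := j + 1) (by omega)
    (by omega) (by omega)]
  congr 1
  rw [Finset.sum_eq_single i]
  · congr 1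
    simp only [Fin.ext_iff, eq_iff_iff]
    omega
  · intro b _ hb
    rw [Ne, Fin.ext_iff] at hb
    apply if_neg
    omega
  · simp

theorem eq_of_intervalRank_eq {N : ℕ} {π ρ : Equiv.Perm (Fin N)} (hπ : Function.Involutive π)
    (hρ : Function.Involutive ρ) (h : ∀ x y, intervalRank ρ x y = intervalRank π x y) :
    π = ρ := by
  have key : ∀ i j : Fin N, i < j → (π i = j ↔ ρ i = j) := by
    intro i j hij
    have h1 := intervalRank_corner π i j hij
    have h2 := intervalRank_corner ρ i j hij
    simp only [h] at h2
    split_ifs at h1 h2 <;> omega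
  have key2 : ∀ i j : Fin N, i ≠ j → (π i = j ↔ ρ i = j) := by
    intro i j hij
    rcases lt_or_gt_of_ne hij with h' | h'
    · exact key i j h'
    · rw [hπ.eq_iff, hρ.eq_iff, eq_comm, key j i h', eq_comm]
  ext i
  by_cases h1 : ρ i = i
  · by_cases h2 : π i = i
    · rw [h1, h2]
    · rw [(key2 i _ (Ne.symm h2)).1 rfl]
  · rw [(key2 i _ (Ne.symm h1)).2 rfl]

/-- If `π` has at least as many arches as `ρ` in every interval, and `π ≠ ρ`, then some arch of
`π` spans an interval in which `π` has more arches. -/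
theorem exists_arch_excess {N : ℕ} {π ρ : Equiv.Perm (Fin N)} (hπ : Function.Involutive π)
    (hρ : Function.Involutive ρ) (hle : ∀ x y, intervalRank ρ x y ≤ intervalRank π x y)
    (hne : π ≠ ρ) : ∃ i j : Fin N, i < j ∧ π i = j ∧ Excess π ρ i (j + 1) := by
  have hex : ∃ n x y, x + n = y ∧ Excess π ρ x y := by
    by_contra hcon
    push Not at hcon
    refine hne (eq_of_intervalRank_eq hπ hρ fun x y => ?_)
    by_cases hxy : y ≤ x
    · rw [intervalRank_eq_zero _ (by omega), intervalRank_eq_zero _ (by omega)]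
    · exact le_antisymm (hle x y) (not_lt.1 (hcon (y - x) x y (by omega)))
  classical
  -- In a shortest interval with excess all proper subintervals have equal counts, so the corner
  -- identity forces the arch from `x` to `y - 1`.
  obtain ⟨n, ⟨x, y, hxy, hE⟩, hmin⟩ : ∃ n, (∃ x y, x + n = y ∧ Excess π ρ x y) ∧
      ∀ k < n, ¬ ∃ x y, x + k = y ∧ Excess π ρ x y :=
    ⟨Nat.find hex, Nat.find_spec hex, fun k hk => Nat.find_min hex hk⟩
  have hmin' : ∀ x' y', x ≤ x' → y' ≤ y → x' ≤ y' → y' - x' < n →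
      intervalRank ρ x' y' = intervalRank π x' y' := by
    intro x' y' h1 h2 h3 h4
    refine le_antisymm (hle x' y') (not_lt.1 fun hlt => hmin _ h4 ⟨x', y', by omega, hlt⟩)
  have h2 : x + 1 < y := by
    by_contra hcon
    unfold Excess at hE
    rw [intervalRank_eq_zero π (by omega)] at hE
    omega
  -- An end beyond `N` could be lowered by one without changing any count, against minimality.
  have hyN : y ≤ N := by
    by_contra hcon
    unfold Excess at hE
    rw [intervalRank_of_le π (by omega : N ≤ y), intervalRank_of_le ρ (by omega : N ≤ y),
      ← intervalRank_of_le π (by omega : N ≤ y - 1), ← intervalRank_of_le ρ (by omega : N ≤ y - 1),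
      hmin' x (y - 1) (by omega) (by omega) (by omega) (by omega)] at hE
    exact lt_irrefl _ hE
  refine ⟨⟨x, by omega⟩, ⟨y - 1, by omega⟩, by rw [Fin.lt_def]; simp; omega, ?_, ?_⟩
  · have hlt : (⟨x, by omega⟩ : Fin N) < ⟨y - 1, by omega⟩ := by rw [Fin.lt_def]; simp; omega
    have h1 := intervalRank_corner π ⟨x, by omega⟩ ⟨y - 1, by omega⟩ hlt
    have h2 := intervalRank_corner ρ ⟨x, by omega⟩ ⟨y - 1, by omega⟩ hlt
    simp only [Nat.sub_add_cancel (by omega : 1 ≤ y)] at h1 h2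
    rw [hmin' (x + 1) (y - 1) (by omega) (by omega) (by omega) (by omega),
      hmin' x (y - 1) (by omega) (by omega) (by omega) (by omega),
      hmin' (x + 1) y (by omega) (by omega) (by omega) (by omega)] at h2
    unfold Excess at hE
    by_contra hcon
    rw [if_neg hcon] at h1
    omega
  · simpa [Nat.sub_add_cancel (by omega : 1 ≤ y)] using hE

/-! ### Curves that can be made to touch a given arch -/

/-- A curve of `π` that can be made to cross the arch `(i, j)`, so that every interval that loses
an arch is one in which `π` has more arches than `ρ`. The index is the length of the cyclic
interval between the ends of the curve that contains `(i, j)`, where the end of the half-lines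
is put at the position `N`. -/
inductive SwapAt {N : ℕ} (π ρ : Equiv.Perm (Fin N)) (i j : Fin N) : ℕ → Prop
  | nested (e f : Fin N) (he : e < i) (hf : j < f) (hef : π e = f)
      (H : ∀ x y : ℕ, e < x → x ≤ i → j < y → y ≤ f → Excess π ρ x y) : SwapAt π ρ i j (f - e)
  | halfLeft (h : Fin N) (hi : h < i) (hh : π h = h)
      (H : ∀ x y : ℕ, h < x → x ≤ i → j < y → y ≤ N → Excess π ρ x y) : SwapAt π ρ i j (N - h)
  | halfRight (h : Fin N) (hj : j < h) (hh : π h = h)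
      (H : ∀ x y : ℕ, x ≤ i → j < y → y ≤ h → Excess π ρ x y) : SwapAt π ρ i j (h + 1)
  | right (e f : Fin N) (he : j < e) (hf : e < f) (hef : π e = f)
      (H : ∀ x y : ℕ, x ≤ i → j < y → y ≤ e → Excess π ρ x y)
      (H' : ∀ x y : ℕ, j < x → x ≤ e → f < y → y ≤ N → Excess π ρ x y) :
      SwapAt π ρ i j (e + (N + 1) - f)
  | left (e f : Fin N) (he : e < f) (hf : f < i) (hef : π e = f)
      (H : ∀ x y : ℕ, f < x → x ≤ i → j < y → y ≤ N → Excess π ρ x y)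
      (H' : ∀ x y : ℕ, x ≤ e → f < y → y ≤ i → Excess π ρ x y) :
      SwapAt π ρ i j (e + (N + 1) - f)

section

variable {N : ℕ} {π ρ : Equiv.Perm (Fin N)}

theorem exists_of_sum_ite_pos {α : Type*} [Fintype α] (P : α → Prop) [DecidablePred P]
    (h : 0 < ∑ a, if P a then 1 else 0) : ∃ a, P a := by
  by_contra hcon
  push Not at hcon
  rw [Finset.sum_eq_zero fun a _ => if_neg (hcon a)] at h
  exact lt_irrefl _ h

/-- Two equalities on intervals `[u, w)` and `[v, z)`, with more arches of `π` in `[v, w)`, force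
an arch of `π` from `[u, v)` to `[w, z)`. -/
theorem exists_arch_of_excess_inter (hle : ∀ x y, intervalRank ρ x y ≤ intervalRank π x y)
    {u v w z : ℕ} (huv : u ≤ v) (hwz : w ≤ z) (hvw : v ≤ w) (h1 : ¬ Excess π ρ u w)
    (h2 : ¬ Excess π ρ v z) (h : Excess π ρ v w) :
    ∃ a : Fin N, u ≤ a.1 ∧ a.1 < v ∧ w ≤ (π a).1 ∧ (π a).1 < z := by
  have e1 := intervalRank_supermodular π huv hwz hvw
  have e2 := intervalRank_supermodular ρ huv hwz hvw
  have := hle u z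
  unfold Excess at *
  apply exists_of_sum_ite_pos
  omega

/-- Two equalities on overlapping intervals `[u, w)` and `[v, z)`, with more arches of `π` in one
of the differences, force a curve of `π` from the overlap to outside of the union. -/
theorem exists_curve_of_excess_sdiff (hπ : Function.Involutive π) (hρ : Function.Involutive ρ)
    (hle : ∀ x y, intervalRank ρ x y ≤ intervalRank π x y)
    {u v w z : ℕ} (huv : u ≤ v) (hvw : v ≤ w) (hwz : w ≤ z) (h1 : ¬ Excess π ρ u w)
    (h2 : ¬ Excess π ρ v z) (h : Excess π ρ u v ∨ Excess π ρ w z) :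
    ∃ p : Fin N, (v ≤ p.1 ∧ p.1 < w) ∧ ((π p).1 < u ∨ z ≤ (π p).1 ∨ (π p).1 = p.1) := by
  have e1 := intervalRank_overlap hπ huv hvw hwz
  have e2 := intervalRank_overlap hρ huv hvw hwz
  have := hle u v
  have := hle w z
  unfold Excess at *
  apply exists_of_sum_ite_pos
  omega

/-- Adding one position changes a count by at most one. So if excess disappears on adding `q`, the
partner of `q` under `π` is not in the shorter interval. -/
theorem intervalRank_succ_right (hπ : Function.Involutive π) (x : ℕ) (q : Fin N) :
    intervalRank π x (q + 1) =
      intervalRank π x q + if x ≤ (π q).1 ∧ (π q).1 < q.1 then 1 else 0 := by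
  have h : (if x ≤ (π q).1 ∧ (π q).1 < q.1 then 1 else 0) =
      ∑ a : Fin N, if a = π q then (if x ≤ (π q).1 ∧ (π q).1 < q.1 then 1 else 0) else 0 := by
    simp
  rw [h]
  unfold intervalRank
  rw [← Finset.sum_add_distrib]
  refine Finset.sum_congr rfl fun a _ => ?_
  by_cases ha : a = π q
  · subst ha
    rw [hπ q]
    split_ifs <;> omega
  · have : (π a).1 ≠ q.1 := fun hq => ha (by rw [← Fin.ext hq, hπ a])
    rw [if_neg ha]
    split_ifs <;> omega

theorem intervalRank_succ_left (q : Fin N) (y : ℕ) :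
    intervalRank π q y =
      intervalRank π (q + 1) y + if q.1 < (π q).1 ∧ (π q).1 < y then 1 else 0 := by
  have h : (if q.1 < (π q).1 ∧ (π q).1 < y then 1 else 0) =
      ∑ a : Fin N, if a = q then (if q.1 < (π q).1 ∧ (π q).1 < y then 1 else 0) else 0 := by
    simp
  rw [h]
  unfold intervalRank
  rw [← Finset.sum_add_distrib]
  refine Finset.sum_congr rfl fun a _ => ?_
  by_cases ha : a = q
  · subst ha
    split_ifs <;> omega
  · have : a.1 ≠ q.1 := fun hq => ha (Fin.ext hq)
    rw [if_neg ha]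
    split_ifs <;> omega

/-- A position in the right part of an interval without excess whose partner is far away gives a
curve that can be swapped with `(i, j)`. -/
theorem swapAt_of_right (hπ : Function.Involutive π) {i j : Fin N} {x₁ y₁ y : ℕ} (hx₁ : x₁ ≤ i)
    (hy : y₁ ≤ y) (H : ∀ x' y' : ℕ, x' ≤ i → j < y' → y' < y₁ → Excess π ρ x' y')
    (H' : ∀ x' y' : ℕ, j < x' → x' < y₁ → y < y' → y' ≤ N → Excess π ρ x' y')
    (p : Fin N) (hjp : j < p) (hp : p.1 < y₁)
    (hπp : (π p).1 < x₁ ∨ y ≤ (π p).1 ∨ (π p).1 = p.1) : ∃ m, SwapAt π ρ i j m := by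
  rw [Fin.lt_def] at hjp
  rcases hπp with h | h | h
  · exact ⟨_, .nested (π p) p (by rw [Fin.lt_def]; omega) hjp (hπ p)
      fun x' y' _ h2 h3 h4 => H x' y' h2 h3 (by omega)⟩
  · exact ⟨_, .right p (π p) hjp (by rw [Fin.lt_def]; omega) rfl
      (fun x' y' h2 h3 h4 => H x' y' h2 h3 (by omega))
      (fun x' y' h2 h3 h4 h5 => H' x' y' h2 (by omega) (by omega) h5)⟩
  · exact ⟨_, .halfRight p hjp (Fin.ext h) fun x' y' h2 h3 h4 => H x' y' h2 h3 (by omega)⟩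

/-- The mirror image of `swapAt_of_right`. -/
theorem swapAt_of_left (hπ : Function.Involutive π) {i j : Fin N} {x₁ y₁ x : ℕ} (hy₁ : j < y₁)
    (hx : x ≤ x₁) (H : ∀ x' y' : ℕ, x₁ < x' → x' ≤ i → j < y' → y' ≤ N → Excess π ρ x' y')
    (H' : ∀ x' y' : ℕ, x' < x → x₁ < y' → y' ≤ i → Excess π ρ x' y')
    (p : Fin N) (hpi : p < i) (hp : x₁ ≤ p.1)
    (hπp : (π p).1 < x ∨ y₁ ≤ (π p).1 ∨ (π p).1 = p.1) : ∃ m, SwapAt π ρ i j m := by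
  rw [Fin.lt_def] at hpi
  rcases hπp with h | h | h
  · exact ⟨_, .left (π p) p (by rw [Fin.lt_def]; omega) hpi (hπ p)
      (fun x' y' h1 h2 h3 h4 => H x' y' (by omega) h2 h3 h4)
      (fun x' y' h1 h2 h3 => H' x' y' (by omega) (by omega) h3)⟩
  · exact ⟨_, .nested p (π p) hpi (by rw [Fin.lt_def]; omega) rfl
      fun x' y' h1 h2 h3 h4 => H x' y' (by omega) h2 h3 (by have := (π p).2; omega)⟩
  · exact ⟨_, .halfLeft p hpi (Fin.ext h) fun x' y' h1 h2 h3 h4 => H x' y' (by omega) h2 h3 h4⟩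

/-- If some interval around the arch `(i, j)` has no excess, then some curve can be swapped with
this arch. -/
theorem exists_swapAt (hπ : Function.Involutive π) (hρ : Function.Involutive ρ)
    (hle : ∀ x y, intervalRank ρ x y ≤ intervalRank π x y) {i j : Fin N} (hij : i < j)
    (hE : Excess π ρ i (j + 1))
    (hz : ∃ y x : ℕ, x ≤ i ∧ j < y ∧ y ≤ N ∧ ¬ Excess π ρ x y) : ∃ m, SwapAt π ρ i j m := by
  classical
  rw [Fin.lt_def] at hij
  -- The tight interval `[x₁, y₁)` around the arch is extremal: `y₁` is least possible, and then
  -- `x₁` is greatest possible.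
  obtain ⟨y₁, ⟨x₀, hx₀, hjy₁, hy₁N, hz₀⟩, hy₁min⟩ : ∃ y₁ : ℕ,
      (∃ x : ℕ, x ≤ i ∧ j < y₁ ∧ y₁ ≤ N ∧ ¬ Excess π ρ x y₁) ∧
      ∀ y < y₁, ¬ ∃ x : ℕ, x ≤ i ∧ j < y ∧ y ≤ N ∧ ¬ Excess π ρ x y :=
    ⟨Nat.find hz, Nat.find_spec hz, fun k hk => Nat.find_min hz hk⟩
  let P : ℕ → Prop := fun x => ¬ Excess π ρ x y₁
  obtain ⟨x₁, hx₁, hz₁, hx₁max⟩ : ∃ x₁ : ℕ, x₁ ≤ i ∧ ¬ Excess π ρ x₁ y₁ ∧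
      ∀ x, x₁ < x → x ≤ i → Excess π ρ x y₁ := by
    refine ⟨Nat.findGreatest P i, Nat.findGreatest_le _, Nat.findGreatest_spec (P := P) hx₀ hz₀, ?_⟩
    intro x h1 h2
    have := Nat.findGreatest_is_greatest h1 h2
    exact not_not.1 this
  have hlow : ∀ x y : ℕ, x ≤ i → j < y → y < y₁ → Excess π ρ x y := by
    intro x y h1 h2 h3
    by_contra hcon
    exact hy₁min y h3 ⟨x, h1, h2, by omega, hcon⟩
  by_cases hsec : ∃ y x : ℕ, x ≤ i ∧ x₁ < x ∧ y₁ < y ∧ y ≤ N ∧ ¬ Excess π ρ x y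
  · obtain ⟨y₂, ⟨x₂, h1, h2, h3, h4, h5⟩, hmin⟩ : ∃ y₂ : ℕ,
        (∃ x : ℕ, x ≤ i ∧ x₁ < x ∧ y₁ < y₂ ∧ y₂ ≤ N ∧ ¬ Excess π ρ x y₂) ∧
        ∀ y < y₂, ¬ ∃ x : ℕ, x ≤ i ∧ x₁ < x ∧ y₁ < y ∧ y ≤ N ∧ ¬ Excess π ρ x y :=
      ⟨Nat.find hsec, Nat.find_spec hsec, fun k hk => Nat.find_min hsec hk⟩
    -- The tight intervals `[x₁, y₁)` and `[x₂, y₂)` meet in `[x₂, y₁)`, which has excess by the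
    -- choice of `x₁`. The resulting arch passes over `(i, j)`, and the choice of `y₂` supplies the
    -- excess needed beyond `y₁`.
    obtain ⟨e, he1, he2, hf1, hf2⟩ := exists_arch_of_excess_inter hle h2.le h3.le (by omega) hz₁ h5
      (hx₁max x₂ h2 h1)
    refine ⟨_, .nested e (π e) (by rw [Fin.lt_def]; omega) (by rw [Fin.lt_def]; omega) rfl ?_⟩
    intro x y g1 g2 g3 g4
    rcases lt_trichotomy y y₁ with hy | hy | hy
    · exact hlow x y g2 g3 hy
    · rw [hy]; exact hx₁max x (by omega) g2
    · by_contra hcon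
      exact hmin y (by omega) ⟨x, g2, by omega, hy, by omega, hcon⟩
  push Not at hsec
  have hhigh : ∀ x y : ℕ, x₁ < x → x ≤ i → j < y → y ≤ N → Excess π ρ x y := by
    intro x y h1 h2 h3 h4
    rcases lt_trichotomy y y₁ with hy | hy | hy
    · exact hlow x y h2 h3 hy
    · rw [hy]; exact hx₁max x h1 h2
    · exact hsec y x h2 h1 hy h4
  -- If there is room between `j` and `y₁`, the curve is sought at a position there; otherwise `y₁ =
  -- j + 1`, and it is sought on the left of `i`.
  by_cases hj : j.1 + 1 < y₁
  · by_cases hr : ∃ y, y ≤ N ∧ (y₁ ≤ y ∧ ∃ x, j.1 < x ∧ x < y₁ ∧ ¬ Excess π ρ x y)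
    · obtain ⟨y', hy'N, hy'⟩ := hr
      let Q : ℕ → Prop := fun y => y₁ ≤ y ∧ ∃ x, j.1 < x ∧ x < y₁ ∧ ¬ Excess π ρ x y
      obtain ⟨h1, x, h2, h3, h4⟩ := Nat.findGreatest_spec (P := Q) hy'N hy'
      -- The right end of the second tight interval is taken as large as possible, so that all
      -- longer intervals have the excess that a side-by-side swap needs.
      obtain ⟨p, ⟨hp1, hp2⟩, hp⟩ := exists_curve_of_excess_sdiff hπ hρ hle (by omega) h3.le h1 hz₁ h4
        (Or.inl (hlow x₁ x hx₁ h2 h3))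
      refine swapAt_of_right hπ hx₁ h1 hlow ?_ p (by rw [Fin.lt_def]; omega) hp2 hp
      intro x' y' g1 g2 g3 g4
      by_contra hcon
      exact Nat.findGreatest_is_greatest g3 g4 ⟨by omega, x', g1, g2, hcon⟩
    · have hq : y₁ - 1 < N := by omega
      have hs : (y₁ - 1) + 1 = y₁ := by omega
      refine swapAt_of_right hπ hx₁ le_rfl hlow ?_ ⟨y₁ - 1, hq⟩ (by rw [Fin.lt_def]; simp; omega)
        (by simp; omega) ?_
      · intro x' y' g1 g2 g3 g4
        by_contra hcon
        exact hr ⟨y', g4, g3.le, x', g1, g2, hcon⟩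
      · have e1 := intervalRank_succ_right hπ x₁ ⟨y₁ - 1, hq⟩
        have e2 := intervalRank_succ_right hρ x₁ ⟨y₁ - 1, hq⟩
        have e3 := hlow x₁ (y₁ - 1) hx₁ (by omega) (by omega)
        simp only [hs] at e1 e2 ⊢
        unfold Excess at hz₁ e3
        split_ifs at e1 e2 <;> omega
  · have hy₁ : y₁ = j + 1 := by omega
    have hx₁i : x₁ < i := by
      -- Since `[i, j + 1)` itself has excess, a tight interval ending at `j + 1` must start before
      -- `i`; the argument is then the mirror image of the previous case.
      refine lt_of_le_of_ne hx₁ fun h => hz₁ ?_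
      rw [h, hy₁]
      exact hE
    by_cases hr : ∃ x, x ≤ x₁ ∧ ∃ y, x₁ < y ∧ y ≤ i ∧ ¬ Excess π ρ x y
    · obtain ⟨x, ⟨h1, y, h2, h3, h4⟩, hmin⟩ : ∃ x : ℕ,
          (x ≤ x₁ ∧ ∃ y : ℕ, x₁ < y ∧ y ≤ i ∧ ¬ Excess π ρ x y) ∧
          ∀ k < x, ¬ (k ≤ x₁ ∧ ∃ y : ℕ, x₁ < y ∧ y ≤ i ∧ ¬ Excess π ρ k y) :=
        ⟨Nat.find hr, Nat.find_spec hr, fun k hk => Nat.find_min hr hk⟩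
      obtain ⟨p, ⟨hp1, hp2⟩, hp⟩ := exists_curve_of_excess_sdiff hπ hρ hle h1 h2.le (by omega) h4 hz₁
        (Or.inr (hhigh y y₁ h2 h3 hjy₁ hy₁N))
      refine swapAt_of_left hπ hjy₁ h1 hhigh ?_ p (by rw [Fin.lt_def]; omega) hp1 hp
      intro x' y' g1 g2 g3
      by_contra hcon
      exact hmin x' g1 ⟨by omega, y', g2, g3, hcon⟩
    · refine swapAt_of_left hπ hjy₁ le_rfl hhigh ?_ ⟨x₁, by omega⟩ (by rw [Fin.lt_def]; exact hx₁i)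
        le_rfl ?_
      · intro x' y' g1 g2 g3
        by_contra hcon
        exact hr ⟨x', g1.le, y', g2, g3, hcon⟩
      · have e1 := intervalRank_succ_left (π := π) ⟨x₁, by omega⟩ y₁
        have e2 := intervalRank_succ_left (π := ρ) ⟨x₁, by omega⟩ y₁
        have e3 := hhigh (x₁ + 1) y₁ (by omega) (by omega) hjy₁ hy₁N
        simp only at e1 e2 ⊢
        unfold Excess at hz₁ e3
        split_ifs at e1 e2 <;> omega

end

/-! ### Right ends as natural numbers -/

section

variable {N : ℕ} {π σ ρ : Equiv.Perm (Fin N)}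

/-- The right end of the curve with left end `x`, where half-lines end at the position `N`. It
is `0` if `x` is not a left end. -/
def curveEnd (π : Equiv.Perm (Fin N)) (x : Fin N) : ℕ :=
  if π x = x then N else if x.1 < (π x).1 then (π x).1 else 0

theorem curveEnd_of_fixed {x : Fin N} (h : π x = x) : curveEnd π x = N := if_pos h

theorem curveEnd_of_lt {x y : Fin N} (h : π x = y) (hxy : x < y) : curveEnd π x = y := by
  subst h
  rw [Fin.lt_def] at hxy
  rw [curveEnd, if_neg (fun h => by rw [h] at hxy; omega), if_pos hxy]

theorem curveEnd_of_gt {x y : Fin N} (h : π x = y) (hxy : y < x) : curveEnd π x = 0 := by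
  subst h
  rw [Fin.lt_def] at hxy
  rw [curveEnd, if_neg (fun h => by rw [h] at hxy; omega), if_neg (by omega)]

theorem curveEnd_cases (π : Equiv.Perm (Fin N)) (x : Fin N) :
    (π x = x ∧ curveEnd π x = N) ∨ (x.1 < (π x).1 ∧ curveEnd π x = (π x).1) ∨
      ((π x).1 < x.1 ∧ curveEnd π x = 0) := by
  rcases lt_trichotomy x (π x) with h | h | h
  · exact Or.inr (Or.inl ⟨h, curveEnd_of_lt rfl h⟩)
  · exact Or.inl ⟨h.symm, curveEnd_of_fixed h.symm⟩
  · exact Or.inr (Or.inr ⟨h, curveEnd_of_gt rfl h⟩)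

theorem coe_lt_rightEnd_iff {x z : Fin N} (hz : IsCurve π z) :
    (x : WithTop (Fin N)) < rightEnd π z ↔ x.1 < curveEnd π z := by
  unfold rightEnd curveEnd
  unfold IsCurve at hz
  rw [Fin.le_def] at hz
  by_cases h : π z = z
  · rw [if_pos h, if_pos h]
    simp
  · have h' : z.1 < (π z).1 := lt_of_le_of_ne hz fun h' => h (Fin.ext h'.symm)
    rw [if_neg h, if_neg h, if_pos h', WithTop.coe_lt_coe, Fin.lt_def]

theorem rightEnd_lt_rightEnd_iff {x z : Fin N} (hx : IsCurve π x) (hz : IsCurve π z) :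
    rightEnd π x < rightEnd π z ↔ curveEnd π x < curveEnd π z := by
  by_cases h : π x = x
  · have h1 : curveEnd π z ≤ N := by
      have := (π z).2
      rcases curveEnd_cases π z with h | h | h <;> omega
    rw [curveEnd_of_fixed h, rightEnd, if_pos h]
    simp only [not_top_lt, false_iff]
    omega
  · rw [rightEnd, if_neg h, coe_lt_rightEnd_iff hz]
    have h' : x < π x := lt_of_le_of_ne hx fun h' => h h'.symm
    rw [curveEnd_of_lt rfl h']

theorem cross_iff {x y : Fin N} (hx : IsCurve π x) (hy : IsCurve π y) :
    Cross π x y ↔ (x.1 < y.1 ∧ y.1 < curveEnd π x ∧ curveEnd π x < curveEnd π y) ∨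
      (y.1 < x.1 ∧ x.1 < curveEnd π y ∧ curveEnd π y < curveEnd π x) := by
  unfold Cross
  rw [coe_lt_rightEnd_iff hx, coe_lt_rightEnd_iff hy, rightEnd_lt_rightEnd_iff hx hy,
    rightEnd_lt_rightEnd_iff hy hx, Fin.lt_def, Fin.lt_def]

theorem inside_iff {z x : Fin N} (hz : IsCurve π z) :
    Inside π z x ↔ z.1 < x.1 ∧ x.1 < curveEnd π z := by
  unfold Inside
  rw [coe_lt_rightEnd_iff hz, Fin.lt_def]

/-- With half-lines ending at `N`, adjacency becomes a statement about inequalities of natural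
numbers, which `omega` can use. -/
theorem borderCommonRegion_iff {x y : Fin N} (hx : IsCurve π x) (hy : IsCurve π y) :
    BorderCommonRegion π x y ↔ ∀ z : Fin N, IsCurve π z → z ≠ x → z ≠ y →
      ¬ ((z.1 < x.1 ∧ x.1 < curveEnd π z ∧ curveEnd π z < curveEnd π x) ∨
        (x.1 < z.1 ∧ z.1 < curveEnd π x ∧ curveEnd π x < curveEnd π z)) →
      ¬ ((z.1 < y.1 ∧ y.1 < curveEnd π z ∧ curveEnd π z < curveEnd π y) ∨
        (y.1 < z.1 ∧ z.1 < curveEnd π y ∧ curveEnd π y < curveEnd π z)) →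
      ((z.1 < x.1 ∧ x.1 < curveEnd π z) ↔ (z.1 < y.1 ∧ y.1 < curveEnd π z)) := by
  unfold BorderCommonRegion
  refine forall_congr' fun z => forall_congr' fun hz => forall_congr' fun _ =>
    forall_congr' fun _ => ?_
  unfold Separates
  rw [cross_iff hz hx, cross_iff hz hy, inside_iff hz, inside_iff hz, not_and, not_and,
    not_not]

/-! ### Conjugation by a transposition -/

theorem involutive_conj_swap (hπ : Function.Involutive π) (p q : Fin N) :
    Function.Involutive (Equiv.swap p q * π * Equiv.swap p q) := by
  intro x
  simp [hπ _]

theorem involutive_mul_swap (hπ : Function.Involutive π) {a b : Fin N} (hab : π a = b) :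
    Function.Involutive (π * Equiv.swap a b) := by
  have hba : π b = a := by rw [← hab, hπ]
  intro x
  by_cases hxa : x = a
  · subst hxa; simp [hba]
  by_cases hxb : x = b
  · subst hxb; simp [hab]
  have h1 : π x ≠ a := fun h => hxb (by rw [← hab, ← h, hπ])
  have h2 : π x ≠ b := fun h => hxa (by rw [← hba, ← h, hπ])
  simp [Equiv.swap_apply_of_ne_of_ne hxa hxb, Equiv.swap_apply_of_ne_of_ne h1 h2, hπ x]

/-! ### The loss of arches in a move -/

theorem sum_le_sum_add_of_eqOn {α : Type*} [Fintype α] [DecidableEq α] {f g : α → ℕ} {k : ℕ}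
    (T : Finset α) (h : ∀ x, x ∉ T → f x = g x) (hT : ∑ x ∈ T, f x ≤ ∑ x ∈ T, g x + k) :
    ∑ x, f x ≤ ∑ x, g x + k := by
  have e : ∑ x ∈ Tᶜ, f x = ∑ x ∈ Tᶜ, g x :=
    Finset.sum_congr rfl fun x hx => h x (Finset.mem_compl.1 hx)
  rw [← Finset.sum_add_sum_compl T f, ← Finset.sum_add_sum_compl T g, e]
  omega

theorem intervalRank_le_of_agree (T : Finset (Fin N)) (h : ∀ x, x ∉ T → σ x = π x) {x y k : ℕ}
    (hT : (∑ a ∈ T, if x ≤ a.1 ∧ a.1 < (π a).1 ∧ (π a).1 < y then 1 else 0) ≤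
      (∑ a ∈ T, if x ≤ a.1 ∧ a.1 < (σ a).1 ∧ (σ a).1 < y then 1 else 0) + k) :
    intervalRank π x y ≤ intervalRank σ x y + k :=
  sum_le_sum_add_of_eqOn T (fun a ha => by rw [h a ha]) hT

/-- Only an interval containing the inner arch but neither outer end loses an arch. This and the
next loss regions are those on which the constructors of `SwapAt` demand excess. -/
theorem intervalRank_nested {a b c d : Fin N} (hab : a < b) (hbc : b < c) (hcd : c < d)
    (hπ : Function.Involutive π) (hσ : Function.Involutive σ)
    (ha : π a = d) (hb : π b = c) (ha' : σ a = c) (hb' : σ b = d)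
    (h : ∀ x, x ≠ a → x ≠ b → x ≠ c → x ≠ d → σ x = π x) (x y : ℕ) :
    intervalRank π x y ≤ intervalRank σ x y +
      if a.1 < x ∧ x ≤ b.1 ∧ c.1 < y ∧ y ≤ d.1 then 1 else 0 := by
  have hc : π c = b := by rw [← hb, hπ]
  have hd : π d = a := by rw [← ha, hπ]
  have hc' : σ c = a := by rw [← ha', hσ]
  have hd' : σ d = b := by rw [← hb', hσ]
  rw [Fin.lt_def] at hab hbc hcd
  apply intervalRank_le_of_agree {a, b, c, d}
  · intro z hz
    simp only [Finset.mem_insert, Finset.mem_singleton, not_or] at hz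
    exact h z hz.1 hz.2.1 hz.2.2.1 hz.2.2.2
  · have h1 : a ∉ ({b, c, d} : Finset (Fin N)) := by
      simp only [Finset.mem_insert, Finset.mem_singleton, Fin.ext_iff]; omega
    have h2 : b ∉ ({c, d} : Finset (Fin N)) := by
      simp only [Finset.mem_insert, Finset.mem_singleton, Fin.ext_iff]; omega
    have h3 : c ∉ ({d} : Finset (Fin N)) := by
      simp only [Finset.mem_singleton, Fin.ext_iff]; omega
    rw [Finset.sum_insert h1, Finset.sum_insert h2, Finset.sum_insert h3, Finset.sum_singleton,
      Finset.sum_insert h1, Finset.sum_insert h2, Finset.sum_insert h3, Finset.sum_singleton,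
      ha, hb, hc, hd, ha', hb', hc', hd']
    split_ifs <;> omega

/-- The two loss regions come from the two old arches: an interval loses `(a, b)` if it stops before
`c`, and `(c, d)` if it starts after `b`. -/
theorem intervalRank_side {a b c d : Fin N} (hab : a < b) (hbc : b < c) (hcd : c < d)
    (hπ : Function.Involutive π) (hσ : Function.Involutive σ)
    (ha : π a = b) (hc : π c = d) (ha' : σ a = c) (hb' : σ b = d)
    (h : ∀ x, x ≠ a → x ≠ b → x ≠ c → x ≠ d → σ x = π x) (x y : ℕ) :
    intervalRank π x y ≤ intervalRank σ x y +
      if (x ≤ a.1 ∧ b.1 < y ∧ y ≤ c.1) ∨ (b.1 < x ∧ x ≤ c.1 ∧ d.1 < y) then 1 else 0 := by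
  have hb : π b = a := by rw [← ha, hπ]
  have hd : π d = c := by rw [← hc, hπ]
  have hc' : σ c = a := by rw [← ha', hσ]
  have hd' : σ d = b := by rw [← hb', hσ]
  rw [Fin.lt_def] at hab hbc hcd
  apply intervalRank_le_of_agree {a, b, c, d}
  · intro z hz
    simp only [Finset.mem_insert, Finset.mem_singleton, not_or] at hz
    exact h z hz.1 hz.2.1 hz.2.2.1 hz.2.2.2
  · have h1 : a ∉ ({b, c, d} : Finset (Fin N)) := by
      simp only [Finset.mem_insert, Finset.mem_singleton, Fin.ext_iff]; omega
    have h2 : b ∉ ({c, d} : Finset (Fin N)) := by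
      simp only [Finset.mem_insert, Finset.mem_singleton, Fin.ext_iff]; omega
    have h3 : c ∉ ({d} : Finset (Fin N)) := by
      simp only [Finset.mem_singleton, Fin.ext_iff]; omega
    rw [Finset.sum_insert h1, Finset.sum_insert h2, Finset.sum_insert h3, Finset.sum_singleton,
      Finset.sum_insert h1, Finset.sum_insert h2, Finset.sum_insert h3, Finset.sum_singleton,
      ha, hb, hc, hd, ha', hb', hc', hd']
    split_ifs <;> omega

/-- This is the nested case with the right end of the outer curve moved to infinity, hence no upper
bound on `y`. -/
theorem intervalRank_halfLeft {h a b : Fin N} (hha : h < a) (hab : a < b)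
    (hπ : Function.Involutive π) (hσ : Function.Involutive σ)
    (hh : π h = h) (ha : π a = b) (hh' : σ h = b) (ha' : σ a = a)
    (H : ∀ x, x ≠ a → x ≠ b → x ≠ h → σ x = π x) (x y : ℕ) :
    intervalRank π x y ≤ intervalRank σ x y +
      if h.1 < x ∧ x ≤ a.1 ∧ b.1 < y then 1 else 0 := by
  have hb : π b = a := by rw [← ha, hπ]
  have hb' : σ b = h := by rw [← hh', hσ]
  rw [Fin.lt_def] at hha hab
  apply intervalRank_le_of_agree {a, b, h}
  · intro z hz
    simp only [Finset.mem_insert, Finset.mem_singleton, not_or] at hz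
    exact H z hz.1 hz.2.1 hz.2.2
  · have h2 : a ∉ ({b, h} : Finset (Fin N)) := by
      simp only [Finset.mem_insert, Finset.mem_singleton, Fin.ext_iff]; omega
    have h3 : b ∉ ({h} : Finset (Fin N)) := by
      simp only [Finset.mem_singleton, Fin.ext_iff]; omega
    rw [Finset.sum_insert h2, Finset.sum_insert h3, Finset.sum_singleton,
      Finset.sum_insert h2, Finset.sum_insert h3, Finset.sum_singleton,
      ha, hb, hh, ha', hb', hh']
    split_ifs <;> omega

theorem intervalRank_halfRight {a b h : Fin N} (hab : a < b) (hbh : b < h)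
    (hπ : Function.Involutive π) (hσ : Function.Involutive σ)
    (hh : π h = h) (ha : π a = b) (ha' : σ a = h) (hb' : σ b = b)
    (H : ∀ x, x ≠ a → x ≠ b → x ≠ h → σ x = π x) (x y : ℕ) :
    intervalRank π x y ≤ intervalRank σ x y +
      if x ≤ a.1 ∧ b.1 < y ∧ y ≤ h.1 then 1 else 0 := by
  have hb : π b = a := by rw [← ha, hπ]
  have hh' : σ h = a := by rw [← ha', hσ]
  rw [Fin.lt_def] at hbh hab
  apply intervalRank_le_of_agree {a, b, h}
  · intro z hz
    simp only [Finset.mem_insert, Finset.mem_singleton, not_or] at hz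
    exact H z hz.1 hz.2.1 hz.2.2
  · have h2 : a ∉ ({b, h} : Finset (Fin N)) := by
      simp only [Finset.mem_insert, Finset.mem_singleton, Fin.ext_iff]; omega
    have h3 : b ∉ ({h} : Finset (Fin N)) := by
      simp only [Finset.mem_singleton, Fin.ext_iff]; omega
    rw [Finset.sum_insert h2, Finset.sum_insert h3, Finset.sum_singleton,
      Finset.sum_insert h2, Finset.sum_insert h3, Finset.sum_singleton,
      ha, hb, hh, ha', hb', hh']
    split_ifs <;> omega

theorem intervalRank_break {a b : Fin N} (hab : a < b)
    (hπ : Function.Involutive π) (ha : π a = b) (ha' : σ a = a) (hb' : σ b = b)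
    (H : ∀ x, x ≠ a → x ≠ b → σ x = π x) (x y : ℕ) :
    intervalRank π x y ≤ intervalRank σ x y + if x ≤ a.1 ∧ b.1 < y then 1 else 0 := by
  have hb : π b = a := by rw [← ha, hπ]
  rw [Fin.lt_def] at hab
  apply intervalRank_le_of_agree {a, b}
  · intro z hz
    simp only [Finset.mem_insert, Finset.mem_singleton, not_or] at hz
    exact H z hz.1 hz.2
  · have h3 : a ∉ ({b} : Finset (Fin N)) := by
      simp only [Finset.mem_singleton, Fin.ext_iff]; omega
    rw [Finset.sum_insert h3, Finset.sum_singleton, Finset.sum_insert h3, Finset.sum_singleton,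
      ha, hb, ha', hb']
    split_ifs <;> omega

/-- Losing one arch is affordable where there is excess. Excess is only asked for `y ≤ N`, as counts
are constant in `y` from there on. -/
theorem intervalRank_le_of_loss (hle : ∀ x y, intervalRank ρ x y ≤ intervalRank π x y)
    {P : ℕ → ℕ → Prop} [∀ x y, Decidable (P x y)]
    (hloss : ∀ x y, intervalRank π x y ≤ intervalRank σ x y + if P x y then 1 else 0)
    (hP : ∀ x y, P x y → y ≤ N → Excess π ρ x y) (x y : ℕ) :
    intervalRank ρ x y ≤ intervalRank σ x y := by
  have key : ∀ y ≤ N, intervalRank ρ x y ≤ intervalRank σ x y := by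
    intro y hy
    have h1 := hloss x y
    have h2 := hle x y
    split_ifs at h1 with h
    · have := hP x y h hy
      unfold Excess at this
      omega
    · omega
  rcases le_total y N with hy | hy
  · exact key y hy
  · rw [intervalRank_of_le ρ hy, intervalRank_of_le σ hy]
    exact key N le_rfl

/-! ### The existence of moves -/

theorem isCurve_of_lt {x y : Fin N} (h : π x = y) (hxy : x < y) : IsCurve π x := by
  unfold IsCurve
  rw [h]
  exact hxy.le

theorem isCurve_of_fixed {x : Fin N} (h : π x = x) : IsCurve π x := h.ge

theorem curveEnd_ne {x y z : Fin N} (hx : π x = y) (hz : z ≠ x) : (π z).1 ≠ y.1 := by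
  intro h
  exact hz (π.injective ((Fin.ext h).trans hx.symm))

/-- A swap of least length with the arch `(i, j)` is a move. -/
theorem exists_move_of_swapAt (hπ : Function.Involutive π)
    (hle : ∀ x y, intervalRank ρ x y ≤ intervalRank π x y) {i j : Fin N} (hij : i < j)
    (hi : π i = j) {m : ℕ} (hm : SwapAt π ρ i j m) (hmin : ∀ k < m, ¬ SwapAt π ρ i j k) :
    ∃ σ : Equiv.Perm (Fin N), Function.Involutive σ ∧ Move π σ ∧
      ∀ x y, intervalRank ρ x y ≤ intervalRank σ x y := by
  have hj : π j = i := by rw [← hi, hπ]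
  have hci := isCurve_of_lt hi hij
  have hRi := curveEnd_of_lt hi hij
  have hij' := Fin.lt_def.1 hij
  cases hm with
  | nested e f he hf hef H =>
    have he' := Fin.lt_def.1 he
    have hf' := Fin.lt_def.1 hf
    have hsw : ∀ x, x ≠ e → x ≠ i → x ≠ j → x ≠ f →
        (Equiv.swap j f * π * Equiv.swap j f) x = π x := by
      intro x h1 h2 h3 h4
      have h5 : π x ≠ j := fun h => h2 (π.injective (h.trans hi.symm))
      have h6 : π x ≠ f := fun h => h1 (π.injective (h.trans hef.symm))
      simp [Equiv.swap_apply_of_ne_of_ne h3 h4, Equiv.swap_apply_of_ne_of_ne h5 h6]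
    have hse : (Equiv.swap j f * π * Equiv.swap j f) e = j := by
      simp [Equiv.swap_apply_of_ne_of_ne (he.trans hij).ne ((he.trans hij).trans hf).ne, hef]
    have hsi : (Equiv.swap j f * π * Equiv.swap j f) i = f := by
      simp [Equiv.swap_apply_of_ne_of_ne hij.ne (hij.trans hf).ne, hi]
    refine ⟨_, involutive_conj_swap hπ j f, Or.inl ⟨e, i, j, f, he, hij, hf,
      Or.inr ⟨hef, hi, ?_⟩, hse, hsi, hsw⟩, ?_⟩
    · rw [borderCommonRegion_iff (isCurve_of_lt hef (he.trans (hij.trans hf))) hci,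
        curveEnd_of_lt hef (he.trans (hij.trans hf)), hRi]
      -- A curve `z` separating the two arches would be swappable with `(i, j)` itself: it needs
      -- excess on fewer intervals and has a smaller index, contradicting `hmin`. The other cases
      -- follow the same pattern.
      intro z hz hze hzi g1 g2
      by_contra hcon
      have n1 := curveEnd_ne hef hze
      have n2 := curveEnd_ne hi hzi
      have n3 := Fin.val_ne_of_ne hze
      have n4 := Fin.val_ne_of_ne hzi
      have hfN := f.2
      rcases curveEnd_cases π z with ⟨h1, h2⟩ | ⟨h1, h2⟩ | ⟨h1, h2⟩
      · rw [h2] at g1 g2 hcon; omega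
      · rw [h2] at g1 g2 hcon
        refine hmin _ ?_ (.nested z (π z) ?_ ?_ rfl fun x y k1 k2 k3 k4 =>
          H x y (by omega) k2 k3 (by omega))
        all_goals (try rw [Fin.lt_def])
        all_goals omega
      · rw [h2] at hcon; omega
    · exact intervalRank_le_of_loss hle (intervalRank_nested he hij hf hπ
        (involutive_conj_swap hπ j f) hef hi hse hsi hsw)
        fun x y h _ => H x y h.1 h.2.1 h.2.2.1 h.2.2.2
  | halfLeft h hhi hh H =>
    have hhi' := Fin.lt_def.1 hhi
    have hsw : ∀ x, x ≠ i → x ≠ j → x ≠ h →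
        (Equiv.swap h i * π * Equiv.swap h i) x = π x := by
      intro x h1 h2 h3
      have h5 : π x ≠ h := fun g => h3 (π.injective (g.trans hh.symm))
      have h6 : π x ≠ i := fun g => h2 (π.injective (g.trans hj.symm))
      simp [Equiv.swap_apply_of_ne_of_ne h3 h1, Equiv.swap_apply_of_ne_of_ne h5 h6]
    have hsh : (Equiv.swap h i * π * Equiv.swap h i) h = j := by
      simp [Equiv.swap_apply_of_ne_of_ne (hhi.trans hij).ne' hij.ne', hi]
    have hsi : (Equiv.swap h i * π * Equiv.swap h i) i = i := by
      simp [hh]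
    refine ⟨_, involutive_conj_swap hπ h i, Or.inr (Or.inl ⟨i, j, h, hij, hi, hh, ?_,
      Or.inl ⟨hhi, hsh, hsi⟩, hsw⟩), ?_⟩
    · rw [borderCommonRegion_iff hci (isCurve_of_fixed hh), curveEnd_of_fixed hh, hRi]
      intro z hz hzi hzh g1 g2
      by_contra hcon
      have n1 := curveEnd_ne hi hzi
      have n3 := Fin.val_ne_of_ne hzh
      have n4 := Fin.val_ne_of_ne hzi
      have hzN := (π z).2
      rcases curveEnd_cases π z with ⟨h1, h2⟩ | ⟨h1, h2⟩ | ⟨h1, h2⟩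
      · rw [h2] at g1 g2 hcon
        refine hmin _ ?_ (.halfLeft z ?_ h1 fun x y k1 k2 k3 k4 => H x y (by omega) k2 k3 k4)
        all_goals (try rw [Fin.lt_def])
        all_goals omega
      · rw [h2] at g1 g2 hcon
        refine hmin _ ?_ (.nested z (π z) ?_ ?_ rfl fun x y k1 k2 k3 k4 =>
          H x y (by omega) k2 k3 (by omega))
        all_goals (try rw [Fin.lt_def])
        all_goals omega
      · rw [h2] at hcon; omega
    · exact intervalRank_le_of_loss hle (intervalRank_halfLeft hhi hij hπ
        (involutive_conj_swap hπ h i) hh hi hsh hsi hsw)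
        fun x y g hy => H x y g.1 g.2.1 g.2.2 hy
  | halfRight h hjh hh H =>
    have hjh' := Fin.lt_def.1 hjh
    have hsw : ∀ x, x ≠ i → x ≠ j → x ≠ h →
        (Equiv.swap j h * π * Equiv.swap j h) x = π x := by
      intro x h1 h2 h3
      have h5 : π x ≠ h := fun g => h3 (π.injective (g.trans hh.symm))
      have h6 : π x ≠ j := fun g => h1 (π.injective (g.trans hi.symm))
      simp [Equiv.swap_apply_of_ne_of_ne h2 h3, Equiv.swap_apply_of_ne_of_ne h6 h5]
    have hsi : (Equiv.swap j h * π * Equiv.swap j h) i = h := by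
      simp [Equiv.swap_apply_of_ne_of_ne hij.ne (hij.trans hjh).ne, hi]
    have hsj : (Equiv.swap j h * π * Equiv.swap j h) j = j := by
      simp [hh]
    refine ⟨_, involutive_conj_swap hπ j h, Or.inr (Or.inl ⟨i, j, h, hij, hi, hh, ?_,
      Or.inr ⟨hjh, hsi, hsj⟩, hsw⟩), ?_⟩
    · rw [borderCommonRegion_iff hci (isCurve_of_fixed hh), curveEnd_of_fixed hh, hRi]
      intro z hz hzi hzh g1 g2
      by_contra hcon
      have n1 := curveEnd_ne hi hzi
      have n2 := curveEnd_ne hh hzh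
      have n3 := Fin.val_ne_of_ne hzh
      have n4 := Fin.val_ne_of_ne hzi
      have hzN := (π z).2
      have hhN := h.2
      rcases curveEnd_cases π z with ⟨h1, h2⟩ | ⟨h1, h2⟩ | ⟨h1, h2⟩
      · rw [h2] at g1 g2 hcon
        refine hmin _ ?_ (.halfRight z ?_ h1 fun x y k1 k2 k3 => H x y k1 k2 (by omega))
        all_goals (try rw [Fin.lt_def])
        all_goals omega
      · rw [h2] at g1 g2 hcon
        refine hmin _ ?_ (.nested z (π z) ?_ ?_ rfl fun x y k1 k2 k3 k4 =>
          H x y k2 k3 (by omega))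
        all_goals (try rw [Fin.lt_def])
        all_goals omega
      · rw [h2] at hcon; omega
    · exact intervalRank_le_of_loss hle (intervalRank_halfRight hij hjh hπ
        (involutive_conj_swap hπ j h) hh hi hsi hsj hsw)
        fun x y g hy => H x y g.1 g.2.1 g.2.2
  | right e f he hf hef H H' =>
    have hfe : π f = e := by rw [← hef, hπ]
    have he' := Fin.lt_def.1 he
    have hf' := Fin.lt_def.1 hf
    have hsw : ∀ x, x ≠ i → x ≠ j → x ≠ e → x ≠ f →
        (Equiv.swap j e * π * Equiv.swap j e) x = π x := by
      intro x h1 h2 h3 h4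
      have h5 : π x ≠ j := fun h => h1 (π.injective (h.trans hi.symm))
      have h6 : π x ≠ e := fun h => h4 (π.injective (h.trans hfe.symm))
      simp [Equiv.swap_apply_of_ne_of_ne h2 h3, Equiv.swap_apply_of_ne_of_ne h5 h6]
    have hsi : (Equiv.swap j e * π * Equiv.swap j e) i = e := by
      simp [Equiv.swap_apply_of_ne_of_ne hij.ne (hij.trans he).ne, hi]
    have hsj : (Equiv.swap j e * π * Equiv.swap j e) j = f := by
      simp [Equiv.swap_apply_of_ne_of_ne (he.trans hf).ne' hf.ne', hef]
    refine ⟨_, involutive_conj_swap hπ j e, Or.inl ⟨i, j, e, f, hij, he, hf,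
      Or.inl ⟨hi, hef, ?_⟩, hsi, hsj, hsw⟩, ?_⟩
    · rw [borderCommonRegion_iff hci (isCurve_of_lt hef hf), curveEnd_of_lt hef hf, hRi]
      intro z hz hzi hze g1 g2
      by_contra hcon
      have n1 := curveEnd_ne hef hze
      have n2 := curveEnd_ne hi hzi
      have n3 := Fin.val_ne_of_ne hze
      have n4 := Fin.val_ne_of_ne hzi
      have hfN := f.2
      have hzN := (π z).2
      have n6 : z.1 ≠ j.1 := by
        intro h
        have hzj : z = j := Fin.ext h
        unfold IsCurve at hz
        rw [hzj, hj, Fin.le_def] at hz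
        omega
      rcases curveEnd_cases π z with ⟨h1, h2⟩ | ⟨h1, h2⟩ | ⟨h1, h2⟩
      · rw [h2] at g1 g2 hcon
        refine hmin _ ?_ (.halfRight z ?_ h1 fun x y k1 k2 k3 => H x y k1 k2 (by omega))
        all_goals (try rw [Fin.lt_def])
        all_goals omega
      · have n5 : (π z).1 ≠ e.1 := by
          intro h
          have : z = f := by rw [← hef, ← Fin.ext h, hπ]
          rw [this] at h1 h
          omega
        rw [h2] at g1 g2 hcon
        -- A separating arch either passes over `(i, j)` and ends before `e`, or starts between `j`
        -- and `e` and passes over `(e, f)`.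
        by_cases hzi' : z.1 < i.1
        · refine hmin _ ?_ (.nested z (π z) ?_ ?_ rfl fun x y k1 k2 k3 k4 =>
            H x y k2 k3 (by omega))
          all_goals (try rw [Fin.lt_def])
          all_goals omega
        · refine hmin _ ?_ (.right z (π z) ?_ ?_ rfl (fun x y k1 k2 k3 => H x y k1 k2 (by omega))
            (fun x y k1 k2 k3 k4 => H' x y k1 (by omega) (by omega) k4))
          all_goals (try rw [Fin.lt_def])
          all_goals omega
      · rw [h2] at hcon; omega
    · exact intervalRank_le_of_loss hle (intervalRank_side hij he hf hπ
        (involutive_conj_swap hπ j e) hi hef hsi hsj hsw)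
        fun x y h hy => h.elim (fun h => H x y h.1 h.2.1 h.2.2)
          (fun h => H' x y h.1 h.2.1 h.2.2 hy)
  | left e f he hf hef H H' =>
    have hfe : π f = e := by rw [← hef, hπ]
    have he' := Fin.lt_def.1 he
    have hf' := Fin.lt_def.1 hf
    have hsw : ∀ x, x ≠ e → x ≠ f → x ≠ i → x ≠ j →
        (Equiv.swap f i * π * Equiv.swap f i) x = π x := by
      intro x h1 h2 h3 h4
      have h5 : π x ≠ f := fun h => h1 (π.injective (h.trans hef.symm))
      have h6 : π x ≠ i := fun h => h4 (π.injective (h.trans hj.symm))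
      simp [Equiv.swap_apply_of_ne_of_ne h2 h3, Equiv.swap_apply_of_ne_of_ne h5 h6]
    have hse : (Equiv.swap f i * π * Equiv.swap f i) e = i := by
      simp [Equiv.swap_apply_of_ne_of_ne he.ne (he.trans hf).ne, hef]
    have hsf : (Equiv.swap f i * π * Equiv.swap f i) f = j := by
      simp [Equiv.swap_apply_of_ne_of_ne (hf.trans hij).ne' hij.ne', hi]
    refine ⟨_, involutive_conj_swap hπ f i, Or.inl ⟨e, f, i, j, he, hf, hij,
      Or.inl ⟨hef, hi, ?_⟩, hse, hsf, hsw⟩, ?_⟩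
    · rw [borderCommonRegion_iff (isCurve_of_lt hef he) hci, curveEnd_of_lt hef he, hRi]
      intro z hz hze hzi g1 g2
      by_contra hcon
      have n1 := curveEnd_ne hef hze
      have n2 := curveEnd_ne hi hzi
      have n3 := Fin.val_ne_of_ne hze
      have n4 := Fin.val_ne_of_ne hzi
      have hjN := j.2
      have hzN := (π z).2
      have n6 : z.1 ≠ f.1 := by
        intro h
        have hzf : z = f := Fin.ext h
        unfold IsCurve at hz
        rw [hzf, hfe, Fin.le_def] at hz
        omega
      rcases curveEnd_cases π z with ⟨h1, h2⟩ | ⟨h1, h2⟩ | ⟨h1, h2⟩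
      · rw [h2] at g1 g2 hcon
        refine hmin _ ?_ (.halfLeft z ?_ h1 fun x y k1 k2 k3 k4 => H x y (by omega) k2 k3 k4)
        all_goals (try rw [Fin.lt_def])
        all_goals omega
      · have n5 : (π z).1 ≠ i.1 := by
          intro h
          have : z = j := by rw [← hi, ← Fin.ext h, hπ]
          rw [this] at h1 h
          omega
        rw [h2] at g1 g2 hcon
        by_cases hzi' : z.1 < e.1
        · refine hmin _ ?_ (.left z (π z) ?_ ?_ rfl
            (fun x y k1 k2 k3 k4 => H x y (by omega) k2 k3 k4)
            (fun x y k1 k2 k3 => H' x y (by omega) (by omega) k3))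
          all_goals (try rw [Fin.lt_def])
          all_goals omega
        · refine hmin _ ?_ (.nested z (π z) ?_ ?_ rfl fun x y k1 k2 k3 k4 =>
            H x y (by omega) k2 k3 (by omega))
          all_goals (try rw [Fin.lt_def])
          all_goals omega
      · rw [h2] at hcon; omega
    · exact intervalRank_le_of_loss hle (intervalRank_side he hf hij hπ
        (involutive_conj_swap hπ f i) hef hi hse hsf hsw)
        fun x y h hy => h.elim (fun h => H' x y h.1 h.2.1 h.2.2)
          (fun h => H x y h.1 h.2.1 h.2.2 hy)

/-- If `π` has at least as many arches as `ρ` in every interval, and `π ≠ ρ`, then there is a move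
from `π` that preserves this property. -/
theorem exists_move (hπ : Function.Involutive π) (hρ : Function.Involutive ρ)
    (hle : ∀ x y, intervalRank ρ x y ≤ intervalRank π x y) (hne : π ≠ ρ) :
    ∃ σ : Equiv.Perm (Fin N), Function.Involutive σ ∧ Move π σ ∧
      ∀ x y, intervalRank ρ x y ≤ intervalRank σ x y := by
  classical
  obtain ⟨i, j, hij, hi, hE⟩ := exists_arch_excess hπ hρ hle hne
  by_cases hs : ∃ m, SwapAt π ρ i j m
  · exact exists_move_of_swapAt hπ hle hij hi (Nat.find_spec hs) fun k hk => Nat.find_min hs hk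
  have hz : ∀ x y : ℕ, x ≤ i → j < y → y ≤ N → Excess π ρ x y := by
    intro x y h1 h2 h3
    by_contra hcon
    exact hs (exists_swapAt hπ hρ hle hij hE ⟨y, x, h1, h2, h3, hcon⟩)
  -- Every interval around the arch now has excess, so breaking it is harmless. A half-line not
  -- crossing it, or an arch above it, would for the same reason be swappable, which is excluded.
  push Not at hs
  have hj : π j = i := by rw [← hi, hπ]
  have hij' := Fin.lt_def.1 hij
  have hsw : ∀ x, x ≠ i → x ≠ j → (π * Equiv.swap i j) x = π x := by
    intro x h1 h2
    simp [Equiv.swap_apply_of_ne_of_ne h1 h2]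
  have hsi : (π * Equiv.swap i j) i = i := by simp [hj]
  have hsj : (π * Equiv.swap i j) j = j := by simp [hi]
  refine ⟨_, involutive_mul_swap hπ hi, Or.inr (Or.inr ⟨i, j, hij, hi, ?_, ?_, hsi, hsj, hsw⟩), ?_⟩
  · intro h hh
    rw [cross_iff (isCurve_of_lt hi hij) (isCurve_of_fixed hh), curveEnd_of_lt hi hij,
      curveEnd_of_fixed hh]
    have hjN := j.2
    have h1 : h ≠ i := by rintro rfl; exact hij.ne (hh.symm.trans hi)
    have h2 : h ≠ j := by rintro rfl; exact hij.ne (hj.symm.trans hh)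
    have h1' := Fin.val_ne_of_ne h1
    have h2' := Fin.val_ne_of_ne h2
    by_contra hcon
    rcases lt_or_gt_of_ne h1 with h3 | h3
    · exact hs _ (.halfLeft h h3 hh fun x y _ k2 k3 k4 => hz x y k2 k3 k4)
    · rw [Fin.lt_def] at h3
      exact hs _ (.halfRight h (by rw [Fin.lt_def]; omega) hh
        fun x y k2 k3 k4 => hz x y k2 k3 (k4.trans h.2.le))
  · rintro z ⟨h1, h2⟩
    rw [hi] at h2
    exact hs _ (.nested z (π z) h1 h2 rfl fun x y _ k2 k3 k4 => hz x y k2 k3 (k4.trans (π z).2.le))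
  · exact intervalRank_le_of_loss hle (intervalRank_break hij hπ hi hsi hsj hsw)
      fun x y h hy => hz x y h.1 h.2 hy

end

/-! ### The grading by crossings and half-lines -/

section

variable {N : ℕ} {π σ ρ : Equiv.Perm (Fin N)}

/-- The number of crossings, `0` or `1`, of curves with ends `x, p` and `y, q`. -/
def crossNumber (x p y q : ℕ) : ℕ :=
  if (x < y ∧ y < p ∧ p < q) ∨ (y < x ∧ x < q ∧ q < p) then 1 else 0

theorem crossNumber_comm (x p y q : ℕ) : crossNumber x p y q = crossNumber y q x p := by
  unfold crossNumber
  congr 1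
  rw [or_comm]

/-- The value 0 of `curveEnd` at right ends makes them contribute nothing, so crossings can be
summed over all positions. -/
theorem crossNumber_zero_right (x p y : ℕ) : crossNumber x p y 0 = 0 := if_neg (by omega)

theorem crossNumber_zero_left (x y q : ℕ) : crossNumber x 0 y q = 0 := if_neg (by omega)

theorem crossNumber_self (x p : ℕ) : crossNumber x p x p = 0 := if_neg (by omega)

/-- The number of ordered pairs of crossing curves with right ends given by `R`. -/
def crossPairs (R : Fin N → ℕ) : ℕ := ∑ x : Fin N, ∑ y : Fin N, crossNumber x (R x) y (R y)

theorem sum_sum_split {α : Type*} [Fintype α] [DecidableEq α] (T : Finset α) (f : α → α → ℕ)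
    (hf : ∀ x y, f x y = f y x) :
    ∑ x, ∑ y, f x y = ∑ x ∈ T, ∑ y ∈ T, f x y + 2 * ∑ z ∈ Tᶜ, ∑ t ∈ T, f z t +
      ∑ x ∈ Tᶜ, ∑ y ∈ Tᶜ, f x y := by
  have h1 : ∑ x ∈ T, ∑ y ∈ Tᶜ, f x y = ∑ z ∈ Tᶜ, ∑ t ∈ T, f z t := by
    rw [Finset.sum_comm]
    exact Finset.sum_congr rfl fun x _ => Finset.sum_congr rfl fun y _ => hf _ _
  have h2 : ∀ x, ∑ y, f x y = ∑ y ∈ T, f x y + ∑ y ∈ Tᶜ, f x y := fun x =>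
    (Finset.sum_add_sum_compl T _).symm
  rw [← Finset.sum_add_sum_compl T]
  simp only [h2, Finset.sum_add_distrib, h1]
  ring

theorem crossPairs_split (T : Finset (Fin N)) (R : Fin N → ℕ) :
    crossPairs R = ∑ x ∈ T, ∑ y ∈ T, crossNumber x (R x) y (R y) +
      2 * ∑ z ∈ Tᶜ, ∑ t ∈ T, crossNumber z (R z) t (R t) +
      ∑ x ∈ Tᶜ, ∑ y ∈ Tᶜ, crossNumber x (R x) y (R y) :=
  sum_sum_split T (fun x y => crossNumber x (R x) y (R y)) fun _ _ => crossNumber_comm _ _ _ _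

/-- Turning a contact of two curves, side by side or nested, into a crossing adds one crossing,
if no curve separates them. -/
theorem crossPairs_swap {R R' : Fin N → ℕ} {a b c : Fin N} {d : ℕ} (hab : a < b) (hbc : b < c)
    (hcd : c.1 < d) (hR : (R a = b ∧ R b = 0 ∧ R c = d) ∨ (R a = d ∧ R b = c ∧ R c = 0))
    (ha' : R' a = c) (hb' : R' b = d) (hc' : R' c = 0)
    (hagree : ∀ z, z ≠ a → z ≠ b → z ≠ c → R' z = R z)
    (hz : ∀ z, z ≠ a → z ≠ b → z ≠ c → R z = 0 ∨
        crossNumber z (R z) a (R a) + crossNumber z (R z) b (R b) + crossNumber z (R z) c (R c) =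
        crossNumber z (R z) a c + crossNumber z (R z) b d) :
    crossPairs R' = crossPairs R + 2 := by
  rw [Fin.lt_def] at hab hbc
  have h1 : a ∉ ({b, c} : Finset (Fin N)) := by
    simp only [Finset.mem_insert, Finset.mem_singleton, Fin.ext_iff]; omega
  have h2 : b ∉ ({c} : Finset (Fin N)) := by
    simp only [Finset.mem_singleton, Fin.ext_iff]; omega
  have hT : ∀ f : Fin N → ℕ, ∑ t ∈ {a, b, c}, f t = f a + f b + f c := by
    intro f
    rw [Finset.sum_insert h1, Finset.sum_insert h2, Finset.sum_singleton, add_assoc]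
  have hne : ∀ z ∈ ({a, b, c} : Finset (Fin N))ᶜ, z ≠ a ∧ z ≠ b ∧ z ≠ c := by
    intro z hz
    simpa only [Finset.mem_compl, Finset.mem_insert, Finset.mem_singleton, not_or] using hz
  rw [crossPairs_split {a, b, c} R, crossPairs_split {a, b, c} R']
  have e1 : ∑ x ∈ ({a, b, c} : Finset (Fin N))ᶜ, ∑ y ∈ ({a, b, c} : Finset (Fin N))ᶜ,
      crossNumber x (R' x) y (R' y) = ∑ x ∈ ({a, b, c} : Finset (Fin N))ᶜ,
      ∑ y ∈ ({a, b, c} : Finset (Fin N))ᶜ, crossNumber x (R x) y (R y) := by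
    refine Finset.sum_congr rfl fun x hx => Finset.sum_congr rfl fun y hy => ?_
    obtain ⟨g1, g2, g3⟩ := hne x hx
    obtain ⟨k1, k2, k3⟩ := hne y hy
    rw [hagree x g1 g2 g3, hagree y k1 k2 k3]
  have e2 : ∑ z ∈ ({a, b, c} : Finset (Fin N))ᶜ, ∑ t ∈ {a, b, c}, crossNumber z (R' z) t (R' t) =
      ∑ z ∈ ({a, b, c} : Finset (Fin N))ᶜ, ∑ t ∈ {a, b, c}, crossNumber z (R z) t (R t) := by
    refine Finset.sum_congr rfl fun z hz' => ?_
    obtain ⟨g1, g2, g3⟩ := hne z hz'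
    rw [hT, hT, hagree z g1 g2 g3, ha', hb', hc', crossNumber_zero_right]
    rcases hz z g1 g2 g3 with h | h
    · simp [h, crossNumber_zero_left]
    · omega
  -- The single new crossing is counted once in each order.
  have e3 : ∑ x ∈ {a, b, c}, ∑ y ∈ {a, b, c}, crossNumber x (R' x) y (R' y) =
      ∑ x ∈ {a, b, c}, ∑ y ∈ {a, b, c}, crossNumber x (R x) y (R y) + 2 := by
    have k1 : crossNumber a c b d = 1 := if_pos (by omega)
    have k2 : crossNumber b d a c = 1 := if_pos (by omega)
    have k3 : crossNumber a b c d = 0 := if_neg (by omega)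
    have k4 : crossNumber c d a b = 0 := if_neg (by omega)
    have k5 : crossNumber a d b c = 0 := if_neg (by omega)
    have k6 : crossNumber b c a d = 0 := if_neg (by omega)
    simp only [hT]
    rcases hR with ⟨h1, h2, h3⟩ | ⟨h1, h2, h3⟩ <;>
    simp only [ha', hb', hc', h1, h2, h3, crossNumber_zero_left, crossNumber_zero_right,
      crossNumber_self, k1, k2, k3, k4, k5, k6]
  rw [e1, e2, e3]
  ring

/-- A third curve meets the old pair and the new pair equally often unless it separates the old
pair, when it would meet only the new one. This is where adjacency enters the grading. -/
theorem crossNumber_side {z w a b c d : ℕ} (hab : a < b) (hbc : b < c) (hcd : c < d)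
    (hzw : z < w) (hza : z ≠ a) (hzb : z ≠ b) (hzc : z ≠ c) (hwa : w ≠ a) (hwb : w ≠ b)
    (hwc : w ≠ c)
    (hsep : ¬ ((z < a ∧ a < w ∧ w < b) ∨ (a < z ∧ z < b ∧ b < w)) →
      ¬ ((z < c ∧ c < w ∧ w < d) ∨ (c < z ∧ z < d ∧ d < w)) →
      ((z < a ∧ a < w) ↔ (z < c ∧ c < w))) :
    crossNumber z w a b + crossNumber z w c d = crossNumber z w a c + crossNumber z w b d := by
  unfold crossNumber
  split_ifs <;> omega

theorem crossNumber_nested {z w a b c d : ℕ} (hab : a < b) (hbc : b < c) (hcd : c < d)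
    (hzw : z < w) (hzb : z ≠ b) (hzc : z ≠ c) (hwa : w ≠ a) (hwb : w ≠ b)
    (hwc : w ≠ c)
    (hsep : ¬ ((z < a ∧ a < w ∧ w < d) ∨ (a < z ∧ z < d ∧ d < w)) →
      ¬ ((z < b ∧ b < w ∧ w < c) ∨ (b < z ∧ z < c ∧ c < w)) →
      ((z < a ∧ a < w) ↔ (z < b ∧ b < w))) :
    crossNumber z w a d + crossNumber z w b c = crossNumber z w a c + crossNumber z w b d := by
  unfold crossNumber
  split_ifs <;> omega

/-- The number of half-lines. -/
def halfLines (π : Equiv.Perm (Fin N)) : ℕ := ∑ x, if π x = x then 1 else 0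

/-- A grading of the involutions: four times the number of crossings, plus the square of the
number of half-lines. -/
def grade (π : Equiv.Perm (Fin N)) : ℕ := 2 * crossPairs (curveEnd π) + halfLines π ^ 2

theorem curveEnd_congr {x : Fin N} (h : σ x = π x) : curveEnd σ x = curveEnd π x := by
  unfold curveEnd
  rw [h]

theorem isCurve_of_curveEnd_pos {x : Fin N} (h : curveEnd π x ≠ 0) : IsCurve π x := by
  unfold IsCurve
  rw [Fin.le_def]
  rcases curveEnd_cases π x with h' | h' | h'
  · rw [h'.1]
  · omega
  · omega

theorem lt_curveEnd {x : Fin N} (h : curveEnd π x ≠ 0) : x.1 < curveEnd π x := by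
  have := x.2
  rcases curveEnd_cases π x with h' | h' | h' <;> omega

theorem curveEnd_ne_of_ne {x p : Fin N} (h : π x ≠ p) (h0 : curveEnd π x ≠ 0) :
    curveEnd π x ≠ p := by
  have := p.2
  have := Fin.val_ne_of_ne h
  rcases curveEnd_cases π x with h' | h' | h' <;> omega

theorem halfLines_eq_of_agree (T : Finset (Fin N)) (h : ∀ x, x ∉ T → σ x = π x)
    (hT : (∑ x ∈ T, if σ x = x then 1 else 0) = ∑ x ∈ T, if π x = x then 1 else 0) :
    halfLines σ = halfLines π := by
  have hle : ∀ σ π : Equiv.Perm (Fin N), (∀ x, x ∉ T → σ x = π x) →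
      ((∑ x ∈ T, if σ x = x then 1 else 0) = ∑ x ∈ T, if π x = x then 1 else 0) →
      halfLines σ ≤ halfLines π := fun σ π h hT =>
    sum_le_sum_add_of_eqOn (k := 0) T (fun x hx => by rw [h x hx]) (by rw [hT, add_zero])
  exact le_antisymm (hle σ π h hT) (hle π σ (fun x hx => (h x hx).symm) hT.symm)

theorem grade_of_moveArchArch (hπ : Function.Involutive π) (hσ : Function.Involutive σ)
    (h : MoveArchArch π σ) : grade σ = grade π + 4 := by
  obtain ⟨a, b, c, d, hab, hbc, hcd, hor, ha', hb', hagree⟩ := h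
  have hc' : σ c = a := by rw [← ha', hσ]
  have hd' : σ d = b := by rw [← hb', hσ]
  have hab' := Fin.lt_def.1 hab
  have hbc' := Fin.lt_def.1 hbc
  have hcd' := Fin.lt_def.1 hcd
  have hvals : (π a = b ∧ π b = a ∧ π c = d ∧ π d = c) ∨
      (π a = d ∧ π b = c ∧ π c = b ∧ π d = a) := by
    rcases hor with ⟨h1, h2, -⟩ | ⟨h1, h2, -⟩
    · exact Or.inl ⟨h1, by rw [← h1, hπ], h2, by rw [← h2, hπ]⟩
    · exact Or.inr ⟨h1, h2, by rw [← h2, hπ], by rw [← h1, hπ]⟩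
  have hh : halfLines σ = halfLines π := by
    apply halfLines_eq_of_agree {a, b, c, d}
    · intro z hz
      simp only [Finset.mem_insert, Finset.mem_singleton, not_or] at hz
      exact hagree z hz.1 hz.2.1 hz.2.2.1 hz.2.2.2
    · refine Finset.sum_congr rfl fun x hx => ?_
      simp only [Finset.mem_insert, Finset.mem_singleton] at hx
      rw [if_neg, if_neg]
      · rw [Fin.ext_iff]
        rcases hx with rfl | rfl | rfl | rfl <;> rcases hvals with ⟨h1, h2, h3, h4⟩ | ⟨h1, h2, h3, h4⟩
        · rw [h1]; omega
        · rw [h1]; omega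
        · rw [h2]; omega
        · rw [h2]; omega
        · rw [h3]; omega
        · rw [h3]; omega
        · rw [h4]; omega
        · rw [h4]; omega
      · rw [Fin.ext_iff]
        rcases hx with rfl | rfl | rfl | rfl
        · rw [ha']; omega
        · rw [hb']; omega
        · rw [hc']; omega
        · rw [hd']; omega
  have hdz : curveEnd π d = 0 := by
    rcases hvals with ⟨-, -, -, h4⟩ | ⟨-, -, -, h4⟩
    · exact curveEnd_of_gt h4 hcd
    · exact curveEnd_of_gt h4 (hab.trans (hbc.trans hcd))
  have hne : ∀ z, z ≠ a → z ≠ b → z ≠ c → curveEnd π z ≠ 0 →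
      curveEnd π z ≠ a ∧ curveEnd π z ≠ b ∧ curveEnd π z ≠ c := by
    intro z h1 h2 h3 h0
    have h4 : z ≠ d := by rintro rfl; exact h0 hdz
    have inj : ∀ p q : Fin N, π p = q → z ≠ p → π z ≠ q := fun p q hpq hzp hzq =>
      hzp (π.injective (hzq.trans hpq.symm))
    rcases hvals with ⟨k1, k2, k3, k4⟩ | ⟨k1, k2, k3, k4⟩
    · exact ⟨curveEnd_ne_of_ne (inj _ _ k2 h2) h0, curveEnd_ne_of_ne (inj _ _ k1 h1) h0,
        curveEnd_ne_of_ne (inj _ _ k4 h4) h0⟩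
    · exact ⟨curveEnd_ne_of_ne (inj _ _ k4 h4) h0, curveEnd_ne_of_ne (inj _ _ k3 h3) h0,
        curveEnd_ne_of_ne (inj _ _ k2 h2) h0⟩
  have key : crossPairs (curveEnd σ) = crossPairs (curveEnd π) + 2 := by
    refine crossPairs_swap (d := d) hab hbc hcd' ?_ (curveEnd_of_lt ha' (hab.trans hbc))
      (curveEnd_of_lt hb' (hbc.trans hcd)) (curveEnd_of_gt hc' (hab.trans hbc)) ?_ ?_
    · rcases hvals with ⟨k1, k2, k3, k4⟩ | ⟨k1, k2, k3, k4⟩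
      · exact Or.inl ⟨curveEnd_of_lt k1 hab, curveEnd_of_gt k2 hab, curveEnd_of_lt k3 hcd⟩
      · exact Or.inr ⟨curveEnd_of_lt k1 (hab.trans (hbc.trans hcd)), curveEnd_of_lt k2 hbc,
          curveEnd_of_gt k3 hbc⟩
    · intro z h1 h2 h3
      by_cases h4 : z = d
      · subst h4
        rw [hdz, curveEnd_of_gt hd' (hbc.trans hcd)]
      · exact curveEnd_congr (hagree z h1 h2 h3 h4)
    · intro z h1 h2 h3
      by_cases h0 : curveEnd π z = 0
      · exact Or.inl h0
      obtain ⟨n1, n2, n3⟩ := hne z h1 h2 h3 h0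
      refine Or.inr ?_
      rcases hor with ⟨k1, k2, hB⟩ | ⟨k1, k2, hB⟩
      · rw [borderCommonRegion_iff (isCurve_of_lt k1 hab) (isCurve_of_lt k2 hcd)] at hB
        have hs := hB z (isCurve_of_curveEnd_pos h0) h1 h3
        have kb : π b = a := by rw [← k1, hπ]
        rw [curveEnd_of_lt k1 hab, curveEnd_of_lt k2 hcd] at hs ⊢
        rw [curveEnd_of_gt kb hab, crossNumber_zero_right, add_zero]
        exact crossNumber_side hab' hbc' hcd' (lt_curveEnd h0) (Fin.val_ne_of_ne h1)
          (Fin.val_ne_of_ne h2) (Fin.val_ne_of_ne h3) n1 n2 n3 hs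
      · have had : a < d := hab.trans (hbc.trans hcd)
        rw [borderCommonRegion_iff (isCurve_of_lt k1 had) (isCurve_of_lt k2 hbc)] at hB
        have hs := hB z (isCurve_of_curveEnd_pos h0) h1 h2
        have kc : π c = b := by rw [← k2, hπ]
        rw [curveEnd_of_lt k1 had, curveEnd_of_lt k2 hbc] at hs ⊢
        rw [curveEnd_of_gt kc hbc, crossNumber_zero_right, add_zero]
        exact crossNumber_nested hab' hbc' hcd' (lt_curveEnd h0)
          (Fin.val_ne_of_ne h2) (Fin.val_ne_of_ne h3) n1 n2 n3 hs
  unfold grade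
  rw [key, hh]
  ring

/-- A half-line behaves as an arch ending at `N`, so `crossPairs_swap` applies with `d = N`: nested
if the half-line is on the left, side by side if on the right. -/
theorem grade_of_moveArchHalfLine (hπ : Function.Involutive π) (hσ : Function.Involutive σ)
    (h : MoveArchHalfLine π σ) : grade σ = grade π + 4 := by
  obtain ⟨a, b, h, hab, ha, hh, hB, hor, hagree⟩ := h
  have hb : π b = a := by rw [← ha, hπ]
  have hab' := Fin.lt_def.1 hab
  rw [borderCommonRegion_iff (isCurve_of_lt ha hab) (isCurve_of_fixed hh), curveEnd_of_lt ha hab,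
    curveEnd_of_fixed hh] at hB
  have inj : ∀ z p q : Fin N, π p = q → z ≠ p → π z ≠ q := fun z p q hpq hzp hzq =>
    hzp (π.injective (hzq.trans hpq.symm))
  have hhl : halfLines σ = halfLines π := by
    have hah : a ≠ h := by rintro rfl; exact hab.ne (hh.symm.trans ha)
    have hbh : b ≠ h := by rintro rfl; exact hab.ne (hb.symm.trans hh)
    apply halfLines_eq_of_agree {a, b, h}
    · intro z hz
      simp only [Finset.mem_insert, Finset.mem_singleton, not_or] at hz
      exact hagree z hz.1 hz.2.1 hz.2.2
    · have h1 : a ∉ ({b, h} : Finset (Fin N)) := by simp [hab.ne, hah]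
      have h2 : b ∉ ({h} : Finset (Fin N)) := by simp [hbh]
      rw [Finset.sum_insert h1, Finset.sum_insert h2, Finset.sum_singleton,
        Finset.sum_insert h1, Finset.sum_insert h2, Finset.sum_singleton, ha, hb, hh]
      rcases hor with ⟨_, k2, k3⟩ | ⟨_, k2, k3⟩
      · have k4 : σ b = h := by rw [← k2, hσ]
        rw [k2, k3, k4]
        simp [hab.ne, hab.ne', hbh, hbh.symm]
      · have k4 : σ h = a := by rw [← k2, hσ]
        rw [k2, k3, k4]
        simp [hab.ne, hab.ne', hah, hah.symm]
  have key : crossPairs (curveEnd σ) = crossPairs (curveEnd π) + 2 := by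
    rcases hor with ⟨hlt, k2, k3⟩ | ⟨hlt, k2, k3⟩
    · have k4 : σ b = h := by rw [← k2, hσ]
      have hlt' := Fin.lt_def.1 hlt
      refine crossPairs_swap (d := N) hlt hab b.2 (Or.inr ⟨curveEnd_of_fixed hh,
        curveEnd_of_lt ha hab, curveEnd_of_gt hb hab⟩) (curveEnd_of_lt k2 (hlt.trans hab))
        (curveEnd_of_fixed k3) (curveEnd_of_gt k4 (hlt.trans hab))
        (fun z h1 h2 h3 => curveEnd_congr (hagree z h2 h3 h1)) ?_
      intro z h1 h2 h3
      by_cases h0 : curveEnd π z = 0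
      · exact Or.inl h0
      have n1 := curveEnd_ne_of_ne (inj z _ _ hh h1) h0
      have n2 := curveEnd_ne_of_ne (inj z _ _ hb h3) h0
      have n3 := curveEnd_ne_of_ne (inj z _ _ ha h2) h0
      refine Or.inr ?_
      have hs := hB z (isCurve_of_curveEnd_pos h0) h2 h1
      rw [curveEnd_of_fixed hh, curveEnd_of_lt ha hab, curveEnd_of_gt hb hab,
        crossNumber_zero_right, add_zero]
      exact crossNumber_nested hlt' hab' b.2 (lt_curveEnd h0)
        (Fin.val_ne_of_ne h2) (Fin.val_ne_of_ne h3) n1 n2 n3 fun g1 g2 => (hs g2 g1).symm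
    · have k4 : σ h = a := by rw [← k2, hσ]
      have hlt' := Fin.lt_def.1 hlt
      refine crossPairs_swap (d := N) hab hlt h.2 (Or.inl ⟨curveEnd_of_lt ha hab,
        curveEnd_of_gt hb hab, curveEnd_of_fixed hh⟩) (curveEnd_of_lt k2 (hab.trans hlt))
        (curveEnd_of_fixed k3) (curveEnd_of_gt k4 (hab.trans hlt))
        (fun z h1 h2 h3 => curveEnd_congr (hagree z h1 h2 h3)) ?_
      intro z h1 h2 h3
      by_cases h0 : curveEnd π z = 0
      · exact Or.inl h0
      have n1 := curveEnd_ne_of_ne (inj z _ _ hb h2) h0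
      have n2 := curveEnd_ne_of_ne (inj z _ _ ha h1) h0
      have n3 := curveEnd_ne_of_ne (inj z _ _ hh h3) h0
      refine Or.inr ?_
      have hs := hB z (isCurve_of_curveEnd_pos h0) h1 h3
      rw [curveEnd_of_fixed hh, curveEnd_of_lt ha hab, curveEnd_of_gt hb hab,
        crossNumber_zero_right, add_zero]
      exact crossNumber_side hab' hlt' h.2 (lt_curveEnd h0) (Fin.val_ne_of_ne h1)
        (Fin.val_ne_of_ne h2) (Fin.val_ne_of_ne h3) n1 n2 n3 hs
  unfold grade
  rw [key, hhl]
  ring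

/-- With `h` half-lines before the move, the square grows by `4 * h + 4`, and exactly `h` crossings
disappear, those of the arch with the half-lines. Another arch, not passing over `(a, b)`, crosses
it precisely when it crosses exactly one of the two new half-lines, and never crosses both. -/
theorem grade_of_moveBreak (hπ : Function.Involutive π) (h : MoveBreak π σ) :
    grade σ = grade π + 4 := by
  obtain ⟨a, b, hab, ha, hall, hB, ha', hb', hagree⟩ := h
  have hb : π b = a := by rw [← ha, hπ]
  have hab' := Fin.lt_def.1 hab
  have h1 : a ∉ ({b} : Finset (Fin N)) := by simp [hab.ne]
  have hT : ∀ f : Fin N → ℕ, ∑ t ∈ {a, b}, f t = f a + f b := fun f => by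
    rw [Finset.sum_insert h1, Finset.sum_singleton]
  have hne : ∀ z ∈ ({a, b} : Finset (Fin N))ᶜ, z ≠ a ∧ z ≠ b := by
    intro z hz
    simpa only [Finset.mem_compl, Finset.mem_insert, Finset.mem_singleton, not_or] using hz
  have e0 : halfLines π = ∑ z ∈ ({a, b} : Finset (Fin N))ᶜ, if π z = z then 1 else 0 := by
    unfold halfLines
    rw [← Finset.sum_add_sum_compl {a, b}, hT, ha, hb]
    simp [hab.ne, hab.ne']
  have e0' : halfLines σ = halfLines π + 2 := by
    rw [e0]
    unfold halfLines
    rw [← Finset.sum_add_sum_compl {a, b}, hT, ha', hb', if_pos rfl, if_pos rfl, add_comm]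
    congr 1
    refine Finset.sum_congr rfl fun z hz => ?_
    rw [hagree z (hne z hz).1 (hne z hz).2]
  have e1 : ∑ x ∈ ({a, b} : Finset (Fin N))ᶜ, ∑ y ∈ ({a, b} : Finset (Fin N))ᶜ,
      crossNumber x (curveEnd σ x) y (curveEnd σ y) = ∑ x ∈ ({a, b} : Finset (Fin N))ᶜ,
      ∑ y ∈ ({a, b} : Finset (Fin N))ᶜ, crossNumber x (curveEnd π x) y (curveEnd π y) := by
    refine Finset.sum_congr rfl fun x hx => Finset.sum_congr rfl fun y hy => ?_
    rw [curveEnd_congr (hagree x (hne x hx).1 (hne x hx).2),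
      curveEnd_congr (hagree y (hne y hy).1 (hne y hy).2)]
  have e2 : ∑ z ∈ ({a, b} : Finset (Fin N))ᶜ, ∑ t ∈ {a, b},
      crossNumber z (curveEnd π z) t (curveEnd π t) =
      ∑ z ∈ ({a, b} : Finset (Fin N))ᶜ, ∑ t ∈ {a, b},
      crossNumber z (curveEnd σ z) t (curveEnd σ t) + halfLines π := by
    rw [e0, ← Finset.sum_add_distrib]
    refine Finset.sum_congr rfl fun z hz => ?_
    obtain ⟨g1, g2⟩ := hne z hz
    rw [hT, hT, curveEnd_congr (hagree z g1 g2), curveEnd_of_fixed ha', curveEnd_of_fixed hb',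
      curveEnd_of_lt ha hab, curveEnd_of_gt hb hab, crossNumber_zero_right]
    have hzb := hB z
    rw [Fin.lt_def, Fin.lt_def, ha] at hzb
    have n1 := Fin.val_ne_of_ne g1
    have n2 := Fin.val_ne_of_ne g2
    have n3 := curveEnd_ne ha g1
    have n4 := curveEnd_ne hb g2
    have bN := b.2
    have zN := (π z).2
    rcases curveEnd_cases π z with ⟨k1, k2⟩ | ⟨k1, k2⟩ | ⟨k1, k2⟩
    · have hc := hall z k1
      rw [cross_iff (isCurve_of_lt ha hab) (isCurve_of_fixed k1), curveEnd_of_lt ha hab, k2] at hc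
      rw [k2, if_pos k1]
      unfold crossNumber
      split_ifs <;> omega
    · have k3 : π z ≠ z := fun h => by rw [h] at k1; omega
      rw [k2, if_neg k3]
      unfold crossNumber
      split_ifs <;> omega
    · have k3 : π z ≠ z := fun h => by rw [h] at k1; omega
      rw [k2, if_neg k3]
      simp [crossNumber_zero_left]
  have e3 : ∑ x ∈ {a, b}, ∑ y ∈ {a, b}, crossNumber x (curveEnd σ x) y (curveEnd σ y) =
      ∑ x ∈ {a, b}, ∑ y ∈ {a, b}, crossNumber x (curveEnd π x) y (curveEnd π y) := by
    have k1 : crossNumber a N b N = 0 := if_neg (by omega)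
    have k2 : crossNumber b N a N = 0 := if_neg (by omega)
    simp only [hT, curveEnd_of_fixed ha', curveEnd_of_fixed hb', curveEnd_of_lt ha hab,
      curveEnd_of_gt hb hab, crossNumber_zero_left, crossNumber_zero_right, crossNumber_self, k1, k2]
  unfold grade
  rw [crossPairs_split {a, b} (curveEnd σ), crossPairs_split {a, b} (curveEnd π), e0', e1, e2, e3]
  ring

theorem grade_of_move (hπ : Function.Involutive π) (hσ : Function.Involutive σ)
    (h : Move π σ) : grade σ = grade π + 4 := by
  rcases h with h | h | h
  · exact grade_of_moveArchArch hπ hσ h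
  · exact grade_of_moveArchHalfLine hπ hσ h
  · exact grade_of_moveBreak hπ h

theorem grade_le (π : Equiv.Perm (Fin N)) : grade π ≤ 3 * N ^ 2 := by
  have h1 : crossPairs (curveEnd π) ≤ N ^ 2 := by
    unfold crossPairs
    calc _ ≤ ∑ x : Fin N, ∑ y : Fin N, 1 := by
          refine Finset.sum_le_sum fun x _ => Finset.sum_le_sum fun y _ => ?_
          unfold crossNumber
          split_ifs <;> omega
      _ = N ^ 2 := by simp [sq]
  have h2 : halfLines π ≤ N := by
    unfold halfLines
    calc _ ≤ ∑ x : Fin N, 1 := by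
          refine Finset.sum_le_sum fun x _ => ?_
          split_ifs <;> omega
      _ = N := by simp
  unfold grade
  have := Nat.pow_le_pow_left h2 2
  omega

/-- A chain of moves between involutions. -/
inductive MoveChain : Equiv.Perm (Fin N) → Equiv.Perm (Fin N) → Prop
  | refl (π : Equiv.Perm (Fin N)) : MoveChain π π
  | step {π σ ρ : Equiv.Perm (Fin N)} (hσ : Function.Involutive σ) (h : Move π σ)
      (h' : MoveChain σ ρ) : MoveChain π ρ

theorem moveChain_of_intervalRank_le (hπ : Function.Involutive π) (hρ : Function.Involutive ρ)
    (hle : ∀ x y, intervalRank ρ x y ≤ intervalRank π x y) : MoveChain π ρ := by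
  induction hn : 3 * N ^ 2 - grade π using Nat.strong_induction_on generalizing π with
  | _ n ih =>
    by_cases hne : π = ρ
    · subst hne
      exact .refl _
    · obtain ⟨σ, hσ, hm, hσρ⟩ := exists_move hπ hρ hle hne
      have h1 := grade_of_move hπ hσ hm
      have h2 := grade_le σ
      exact .step hσ hm (ih _ (by omega) hσ hσρ rfl)

theorem MoveChain.eq_or_grade (h : MoveChain π ρ) (hπ : Function.Involutive π) :
    π = ρ ∨ grade π + 4 ≤ grade ρ := by
  induction h with
  | refl π => exact Or.inl rfl
  | step hσ hm _ ih =>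
    have h1 := grade_of_move hπ hσ hm
    rcases ih hσ with h | h
    · subst h; exact Or.inr h1.ge
    · exact Or.inr (by omega)

end

/-! ### Orbit closures -/

section

variable {N : ℕ} {π σ ρ : Equiv.Perm (Fin N)}

theorem mem_borelOrbit_self (M : Matrix (Fin N) (Fin N) ℂ) : M ∈ borelOrbit M :=
  ⟨1, by simpa using Matrix.blockTriangular_one, by simp⟩

/-- Conjugation by an element of `B` is continuous and preserves the orbit, hence its closure; one
limit point therefore brings its whole orbit. -/
theorem borelOrbit_subset_closure_of_mem {M S : Matrix (Fin N) (Fin N) ℂ}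
    (h : S ∈ closure (borelOrbit M)) : borelOrbit S ⊆ closure (borelOrbit M) := by
  rintro _ ⟨b, hb, rfl⟩
  have hc : Continuous fun X : Matrix (Fin N) (Fin N) ℂ =>
      (b : Matrix (Fin N) (Fin N) ℂ) * X * ((b⁻¹ : GL (Fin N) ℂ) : Matrix (Fin N) (Fin N) ℂ) := by
    fun_prop
  refine map_mem_closure (f := fun X : Matrix (Fin N) (Fin N) ℂ =>
    (b : Matrix (Fin N) (Fin N) ℂ) * X * ((b⁻¹ : GL (Fin N) ℂ) : Matrix (Fin N) (Fin N) ℂ)) hc h ?_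
  rintro _ ⟨c, hc, rfl⟩
  refine ⟨b * c, ?_, ?_⟩
  · rw [Units.val_mul]
    exact hb.mul hc
  · simp only [mul_inv_rev, Units.val_mul, Matrix.mul_assoc]

theorem closure_subset_zariskiClosure (S : Set (Matrix (Fin N) (Fin N) ℂ)) :
    closure S ⊆ zariskiClosure S := by
  intro X hX f hf
  have hcont : Continuous fun Y : Matrix (Fin N) (Fin N) ℂ =>
      MvPolynomial.eval (fun p : Fin N × Fin N => Y p.1 p.2) f := by
    have h1 : Continuous fun (Y : Matrix (Fin N) (Fin N) ℂ) (p : Fin N × Fin N) => Y p.1 p.2 :=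
      continuous_pi fun p => continuous_id.matrix_elem p.1 p.2
    exact (MvPolynomial.continuous_eval f).comp h1
  have hcl : IsClosed {Y : Matrix (Fin N) (Fin N) ℂ |
      MvPolynomial.eval (fun p : Fin N × Fin N => Y p.1 p.2) f = 0} :=
    isClosed_eq hcont continuous_const
  exact hcl.closure_subset_iff.2 (fun Y hY => hf Y hY) hX

theorem mem_borelOrbit_of_mul_eq {M X b : Matrix (Fin N) (Fin N) ℂ} (htri : b.BlockTriangular id)
    (hdiag : ∀ i, b i i ≠ 0) (h : b * M = X * b) : X ∈ borelOrbit M := by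
  have hdet : IsUnit b.det := by
    rw [Matrix.det_of_isUpperTriangular htri, isUnit_iff_ne_zero]
    exact Finset.prod_ne_zero_iff.2 fun i _ => hdiag i
  refine ⟨Matrix.GeneralLinearGroup.mk'' b hdet, htri, ?_⟩
  have h1 : ((Matrix.GeneralLinearGroup.mk'' b hdet : GL (Fin N) ℂ) :
      Matrix (Fin N) (Fin N) ℂ) = b := rfl
  rw [h1, h, Matrix.mul_assoc]
  have h2 : b * ((Matrix.GeneralLinearGroup.mk'' b hdet)⁻¹ : GL (Fin N) ℂ).1 = 1 := 
    Units.mul_inv (Matrix.GeneralLinearGroup.mk'' b hdet)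
  rw [h2, Matrix.mul_one]

/-- The matrix with the given columns. -/
def ofCols (B : Fin N → Fin N → ℂ) : Matrix (Fin N) (Fin N) ℂ := Matrix.of fun x y => B y x

theorem col_ofCols (B : Fin N → Fin N → ℂ) (y : Fin N) : (ofCols B).col y = B y := rfl

/-- The columns of `π_<`. -/
def archCol (π : Equiv.Perm (Fin N)) (y : Fin N) : Fin N → ℂ :=
  if π y < y then Pi.single (π y) 1 else 0

theorem archCol_of_lt {x y : Fin N} (h : π y = x) (hxy : x < y) :
    archCol π y = Pi.single x 1 := by
  subst h
  exact if_pos hxy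

theorem archCol_of_le {x y : Fin N} (h : π y = x) (hxy : y ≤ x) : archCol π y = 0 := by
  subst h
  exact if_neg hxy.not_gt

theorem upperPart_eq_ofCols (hπ : Function.Involutive π) : upperPart π = ofCols (archCol π) := by
  ext x y
  unfold upperPart ofCols archCol
  rw [Matrix.of_apply, Matrix.of_apply]
  by_cases h : π x = y
  · have h' : π y = x := by rw [← h, hπ]
    rw [h']
    by_cases hxy : x < y
    · simp [h, hxy]
    · simp [hxy]
  · have h' : π y ≠ x := fun h' => h (by rw [← h', hπ])
    rw [if_neg fun hh => h hh.2]
    split_ifs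
    · rw [Pi.single_eq_of_ne h'.symm]
    · rfl

/-- `σ_<` lies in the closure of the orbit of `π_<` if there are upper triangular matrices with
columns `B t` that conjugate `π_<` into matrices with columns `C t`, which tend to `σ_<`. -/
theorem upperPart_mem_closure (hπ : Function.Involutive π) (hσ : Function.Involutive σ)
    (B C : ℂ → Fin N → Fin N → ℂ) (hC : ∀ y, Continuous fun t => C t y)
    (hC0 : ∀ y, C 0 y = archCol σ y) (htri : ∀ t y x, y < x → B t y x = 0)
    (hdiag : ∀ t, t ≠ 0 → ∀ y, B t y y ≠ 0)
    (hint : ∀ t y, (if π y < y then B t (π y) else 0) = (ofCols (C t)).mulVec (B t y)) :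
    upperPart σ ∈ closure (borelOrbit (upperPart π)) := by
  have hcont : Continuous fun t => ofCols (C t) :=
    continuous_pi fun x => continuous_pi fun y => (continuous_apply x).comp (hC y)
  have h0 : ofCols (C 0) = upperPart σ := by
    rw [upperPart_eq_ofCols hσ]
    congr 1
    funext y
    exact hC0 y
  have hmem : ∀ t : ℂ, t ≠ 0 → ofCols (C t) ∈ borelOrbit (upperPart π) := by
    intro t ht
    refine mem_borelOrbit_of_mul_eq (b := ofCols (B t)) (fun x y hxy => htri t y x hxy)
      (hdiag t ht) ?_
    rw [upperPart_eq_ofCols hπ]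
    ext x y
    have h1 : (ofCols (B t)).mulVec (archCol π y) = (ofCols (C t)).mulVec (B t y) := by
      rw [← hint t y]
      unfold archCol
      split_ifs
      · rw [Matrix.mulVec_single_one, col_ofCols]
      · rw [Matrix.mulVec_zero]
    exact congrFun h1 x
  have htend : Filter.Tendsto (fun t => ofCols (C t)) (nhdsWithin 0 {0}ᶜ)
      (nhds (upperPart σ)) := by
    rw [← h0]
    exact (hcont.tendsto 0).mono_left nhdsWithin_le_nhds
  refine mem_closure_of_tendsto htend ?_
  filter_upwards [self_mem_nhdsWithin] with t ht
  exact hmem t ht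

/-- In the new basis `B t` the map sends the column at `c` to `e_a + t e_b`, tending to `e_a`. The
column `e_c - t e_d` at `d` is chosen so that its image stays `e_a` while `e_d` goes to `e_b`. -/
theorem mem_closure_of_nested {a b c d : Fin N} (hab : a < b) (hbc : b < c) (hcd : c < d)
    (hπ : Function.Involutive π) (hσ : Function.Involutive σ)
    (ha : π a = d) (hb : π b = c) (ha' : σ a = c) (hb' : σ b = d)
    (h : ∀ x, x ≠ a → x ≠ b → x ≠ c → x ≠ d → σ x = π x) :
    upperPart σ ∈ closure (borelOrbit (upperPart π)) := by
  have hc : π c = b := by rw [← hb, hπ]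
  have hd : π d = a := by rw [← ha, hπ]
  have hc' : σ c = a := by rw [← ha', hσ]
  have hd' : σ d = b := by rw [← hb', hσ]
  have hac := hab.trans hbc
  have hbd := hbc.trans hcd
  have had := hab.trans hbd
  refine upperPart_mem_closure hπ hσ
    (fun t y => if y = b then Pi.single a 1 + t • Pi.single b 1 else
      if y = d then Pi.single c 1 - t • Pi.single d 1 else Pi.single y 1)
    (fun t y => if y = c then Pi.single a 1 + t • Pi.single b 1 else archCol σ y) ?_ ?_ ?_ ?_ ?_
  · intro y
    split_ifs <;> fun_prop
  · intro y
    by_cases hy : y = c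
    · subst hy
      simp [archCol_of_lt hc' hac]
    · simp [hy]
  · intro t y x hyx
    split_ifs with h1 h2
    · subst h1
      simp [(hab.trans hyx).ne', hyx.ne']
    · subst h2
      simp [(hcd.trans hyx).ne', hyx.ne']
    · simp [hyx.ne']
  · intro t ht y
    split_ifs with h1 h2
    · subst h1
      simp [hab.ne', ht]
    · subst h2
      simp [hcd.ne', ht]
    · simp
  · intro t y
    by_cases ya : y = a
    · subst ya
      simp [ha, had.not_gt, hab.ne, had.ne, hac.ne, col_ofCols,
        archCol_of_le ha' hac.le]
    by_cases yb : y = b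
    · subst yb
      simp [hb, hbc.not_gt, hbc.ne, hac.ne, col_ofCols, Matrix.mulVec_add,
        Matrix.mulVec_smul, archCol_of_le ha' hac.le, archCol_of_le hb' hbd.le]
    by_cases yc : y = c
    · subst yc
      simp [hc, hbc, hbc.ne', hcd.ne, col_ofCols]
    by_cases yd : y = d
    · subst yd
      simp [hd, had, hab.ne, had.ne, hbd.ne', hcd.ne', col_ofCols, Matrix.mulVec_sub,
        Matrix.mulVec_smul, archCol_of_lt hd' hbd]
    have p1 : π y ≠ b := fun g => yc (by rw [← hb, ← g, hπ])
    have p2 : π y ≠ d := fun g => ya (by rw [← hd, ← g, hπ])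
    simp [yb, yc, yd, p1, p2, col_ofCols, h y ya yb yc yd, archCol]

/-- Here `e_b ↦ t e_a` and `e_c ↦ e_a`, so `e_b - t e_c` is killed and can replace `e_c` in the
basis; as the image of `e_d` it tends to `e_b`. -/
theorem mem_closure_of_side {a b c d : Fin N} (hab : a < b) (hbc : b < c) (hcd : c < d)
    (hπ : Function.Involutive π) (hσ : Function.Involutive σ)
    (ha : π a = b) (hc : π c = d) (ha' : σ a = c) (hb' : σ b = d)
    (h : ∀ x, x ≠ a → x ≠ b → x ≠ c → x ≠ d → σ x = π x) :
    upperPart σ ∈ closure (borelOrbit (upperPart π)) := by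
  have hb : π b = a := by rw [← ha, hπ]
  have hd : π d = c := by rw [← hc, hπ]
  have hc' : σ c = a := by rw [← ha', hσ]
  have hd' : σ d = b := by rw [← hb', hσ]
  have hac := hab.trans hbc
  have hbd := hbc.trans hcd
  have had := hab.trans hbd
  refine upperPart_mem_closure hπ hσ
    (fun t y => if y = a then t • Pi.single a 1 else
      if y = c then Pi.single b 1 - t • Pi.single c 1 else Pi.single y 1)
    (fun t y => if y = b then t • Pi.single a 1 else
      if y = d then Pi.single b 1 - t • Pi.single c 1 else archCol σ y) ?_ ?_ ?_ ?_ ?_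
  · intro y
    split_ifs <;> fun_prop
  · intro y
    by_cases hy : y = b
    · subst hy
      simp [archCol_of_le hb' hbd.le]
    by_cases hy' : y = d
    · subst hy'
      simp [archCol_of_lt hd' hbd, hbd.ne']
    · simp [hy, hy']
  · intro t y x hyx
    split_ifs with h1 h2
    · subst h1
      simp [hyx.ne']
    · subst h2
      simp [(hbc.trans hyx).ne', hyx.ne']
    · simp [hyx.ne']
  · intro t ht y
    split_ifs with h1 h2
    · subst h1
      simp [ht]
    · subst h2
      simp [hbc.ne', ht]
    · simp
  · intro t y
    by_cases ya : y = a
    · subst ya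
      simp [ha, hab.not_gt, hab.ne, had.ne, col_ofCols, Matrix.mulVec_smul,
        archCol_of_le ha' hac.le]
    by_cases yb : y = b
    · subst yb
      simp [hb, hab, hab.ne', hbc.ne, col_ofCols]
    by_cases yc : y = c
    · subst yc
      simp [hc, hcd.not_gt, hcd.ne, hac.ne', hbc.ne', col_ofCols, Matrix.mulVec_sub,
        Matrix.mulVec_smul, archCol_of_lt hc' hac]
    by_cases yd : y = d
    · subst yd
      simp [hd, hcd, hac.ne', had.ne', hbd.ne', hcd.ne', col_ofCols]
    have p1 : π y ≠ a := fun g => yb (by rw [← ha, ← g, hπ])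
    have p2 : π y ≠ c := fun g => yd (by rw [← hc, ← g, hπ])
    simp [ya, yb, yc, yd, p1, p2, col_ofCols, h y ya yb yc yd, archCol]

/-- The degeneration is that of the nested arches without the fourth point;
`mem_closure_of_halfRight` relates to `mem_closure_of_side` in the same way. -/
theorem mem_closure_of_halfLeft {h a b : Fin N} (hha : h < a) (hab : a < b)
    (hπ : Function.Involutive π) (hσ : Function.Involutive σ)
    (hh : π h = h) (ha : π a = b) (hh' : σ h = b) (ha' : σ a = a)
    (H : ∀ x, x ≠ a → x ≠ b → x ≠ h → σ x = π x) :
    upperPart σ ∈ closure (borelOrbit (upperPart π)) := by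
  have hb : π b = a := by rw [← ha, hπ]
  have hb' : σ b = h := by rw [← hh', hσ]
  have hhb := hha.trans hab
  refine upperPart_mem_closure hπ hσ
    (fun t y => if y = a then Pi.single h 1 + t • Pi.single a 1 else Pi.single y 1)
    (fun t y => if y = b then Pi.single h 1 + t • Pi.single a 1 else archCol σ y) ?_ ?_ ?_ ?_ ?_
  · intro y
    split_ifs <;> fun_prop
  · intro y
    by_cases hy : y = b
    · subst hy
      simp [archCol_of_lt hb' hhb]
    · simp [hy]
  · intro t y x hyx
    split_ifs with h1
    · subst h1
      simp [(hha.trans hyx).ne', hyx.ne']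
    · simp [hyx.ne']
  · intro t ht y
    split_ifs with h1
    · subst h1
      simp [hha.ne', ht]
    · simp
  · intro t y
    by_cases ya : y = a
    · subst ya
      simp [ha, hab.not_gt, hab.ne, hhb.ne, col_ofCols, Matrix.mulVec_add,
        Matrix.mulVec_smul, archCol_of_le ha' le_rfl, archCol_of_le hh' hhb.le]
    by_cases yb : y = b
    · subst yb
      simp [hb, hab, hab.ne', col_ofCols]
    by_cases yh : y = h
    · subst yh
      simp [hh, hha.ne, hhb.ne, col_ofCols, archCol_of_le hh' hhb.le]
    have p1 : π y ≠ a := fun g => yb (by rw [← ha, ← g, hπ])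
    simp [ya, yb, p1, col_ofCols, H y ya yb yh, archCol]

theorem mem_closure_of_halfRight {a b h : Fin N} (hab : a < b) (hbh : b < h)
    (hπ : Function.Involutive π) (hσ : Function.Involutive σ)
    (hh : π h = h) (ha : π a = b) (ha' : σ a = h) (hb' : σ b = b)
    (H : ∀ x, x ≠ a → x ≠ b → x ≠ h → σ x = π x) :
    upperPart σ ∈ closure (borelOrbit (upperPart π)) := by
  have hb : π b = a := by rw [← ha, hπ]
  have hh' : σ h = a := by rw [← ha', hσ]
  have hah := hab.trans hbh
  refine upperPart_mem_closure hπ hσ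
    (fun t y => if y = a then t • Pi.single a 1 else
      if y = h then Pi.single b 1 - t • Pi.single h 1 else Pi.single y 1)
    (fun t y => if y = b then t • Pi.single a 1 else archCol σ y) ?_ ?_ ?_ ?_ ?_
  · intro y
    split_ifs <;> fun_prop
  · intro y
    by_cases hy : y = b
    · subst hy
      simp [archCol_of_le hb' le_rfl]
    · simp [hy]
  · intro t y x hyx
    split_ifs with h1 h2
    · subst h1
      simp [hyx.ne']
    · subst h2
      simp [(hbh.trans hyx).ne', hyx.ne']
    · simp [hyx.ne']
  · intro t ht y
    split_ifs with h1 h2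
    · subst h1
      simp [ht]
    · subst h2
      simp [hbh.ne', ht]
    · simp
  · intro t y
    by_cases ya : y = a
    · subst ya
      simp [ha, hab.not_gt, hab.ne, col_ofCols, Matrix.mulVec_smul,
        archCol_of_le ha' hah.le]
    by_cases yb : y = b
    · subst yb
      simp [hb, hab, hab.ne', hbh.ne, col_ofCols]
    by_cases yh : y = h
    · subst yh
      simp [hh, hah.ne', hbh.ne', col_ofCols, Matrix.mulVec_sub, Matrix.mulVec_smul,
        archCol_of_lt hh' hah]
    have p1 : π y ≠ a := fun g => yb (by rw [← ha, ← g, hπ])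
    have p2 : π y ≠ h := fun g => yh (by rw [← hh, ← g, hπ])
    simp [ya, yb, yh, p1, p2, col_ofCols, H y ya yb yh, archCol]

theorem mem_closure_of_break {a b : Fin N} (hab : a < b)
    (hπ : Function.Involutive π) (hσ : Function.Involutive σ)
    (ha : π a = b) (ha' : σ a = a) (hb' : σ b = b)
    (H : ∀ x, x ≠ a → x ≠ b → σ x = π x) :
    upperPart σ ∈ closure (borelOrbit (upperPart π)) := by
  have hb : π b = a := by rw [← ha, hπ]
  refine upperPart_mem_closure hπ hσ
    (fun t y => if y = a then t • Pi.single a 1 else Pi.single y 1)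
    (fun t y => if y = b then t • Pi.single a 1 else archCol σ y) ?_ ?_ ?_ ?_ ?_
  · intro y
    split_ifs <;> fun_prop
  · intro y
    by_cases hy : y = b
    · subst hy
      simp [archCol_of_le hb' le_rfl]
    · simp [hy]
  · intro t y x hyx
    split_ifs with h1
    · subst h1
      simp [hyx.ne']
    · simp [hyx.ne']
  · intro t ht y
    split_ifs with h1
    · subst h1
      simp [ht]
    · simp
  · intro t y
    by_cases ya : y = a
    · subst ya
      simp [ha, hab.not_gt, hab.ne, col_ofCols, Matrix.mulVec_smul,
        archCol_of_le ha' le_rfl]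
    by_cases yb : y = b
    · subst yb
      simp [hb, hab, hab.ne', col_ofCols]
    have p1 : π y ≠ a := fun g => yb (by rw [← ha, ← g, hπ])
    simp [ya, yb, p1, col_ofCols, H y ya yb, archCol]

theorem mem_closure_of_move (hπ : Function.Involutive π) (hσ : Function.Involutive σ)
    (h : Move π σ) : upperPart σ ∈ closure (borelOrbit (upperPart π)) := by
  rcases h with ⟨a, b, c, d, hab, hbc, hcd, ⟨h1, h2, -⟩ | ⟨h1, h2, -⟩, ha', hb', hag⟩ |
    ⟨a, b, h, hab, ha, hh, -, ⟨hlt, h1, h2⟩ | ⟨hlt, h1, h2⟩, hag⟩ |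
    ⟨a, b, hab, ha, -, -, ha', hb', hag⟩
  · exact mem_closure_of_side hab hbc hcd hπ hσ h1 h2 ha' hb' hag
  · exact mem_closure_of_nested hab hbc hcd hπ hσ h1 h2 ha' hb' hag
  · exact mem_closure_of_halfLeft hlt hab hπ hσ hh ha h1 h2 hag
  · exact mem_closure_of_halfRight hab hlt hπ hσ hh ha h1 h2 hag
  · exact mem_closure_of_break hab hπ hσ ha ha' hb' hag

theorem MoveChain.borelOrbit_subset_closure (h : MoveChain π ρ) (hπ : Function.Involutive π) :
    borelOrbit (upperPart ρ) ⊆ closure (borelOrbit (upperPart π)) := by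
  induction h with
  | refl π => exact subset_closure
  | step hσ hm _ ih =>
    exact (ih hσ).trans (closure_minimal
      (borelOrbit_subset_closure_of_mem (mem_closure_of_move hπ hσ hm)) isClosed_closure)

/-! ### Rank conditions on the Zariski closure -/

theorem det_mul_eq_zero_of_card_lt {m n K : Type*} [Fintype m] [DecidableEq m] [Fintype n]
    [Field K] (A : Matrix m n K) (B : Matrix n m K) (h : Fintype.card n < Fintype.card m) :
    (A * B).det = 0 := by
  by_contra hdet
  have h1 : (A * B).rank = Fintype.card m :=
    Matrix.rank_of_isUnit _ ((Matrix.isUnit_iff_isUnit_det _).2 (isUnit_iff_ne_zero.2 hdet))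
  have h2 := (Matrix.rank_mul_le_left A B).trans (Matrix.rank_le_card_width A)
  omega

/-- The left ends of the arches of `π` in `[x, y)`. -/
abbrev ArchIn (π : Equiv.Perm (Fin N)) (x y : ℕ) : Type :=
  {a : Fin N // x ≤ a.1 ∧ a.1 < (π a).1 ∧ (π a).1 < y}

theorem card_archIn (π : Equiv.Perm (Fin N)) (x y : ℕ) :
    Fintype.card (ArchIn π x y) = intervalRank π x y := by
  rw [Fintype.card_subtype, Finset.card_filter]
  rfl

/-- The minor with rows at the left ends and columns at the right ends of the arches of `ρ` in `[x,
y)` is 1 at `ρ_<`. On the orbit of `π_<` this block factors through the arches of `π` in `[x, y)`,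
so it would vanish if these were fewer. -/
theorem intervalRank_le_of_subset_zariskiClosure
    (h : borelOrbit (upperPart ρ) ⊆ zariskiClosure (borelOrbit (upperPart π))) (x y : ℕ) :
    intervalRank ρ x y ≤ intervalRank π x y := by
  by_contra hlt
  rw [not_le] at hlt
  let F : Matrix (ArchIn ρ x y) (ArchIn ρ x y) (MvPolynomial (Fin N × Fin N) ℂ) :=
    Matrix.of fun s t => MvPolynomial.X (s.1, ρ t.1)
  have hF : ∀ Y : Matrix (Fin N) (Fin N) ℂ,
      MvPolynomial.eval (fun p : Fin N × Fin N => Y p.1 p.2) F.det =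
        (Matrix.of fun s t : ArchIn ρ x y => Y s.1 (ρ t.1)).det := by
    intro Y
    rw [RingHom.map_det]
    congr 1
    ext s t
    simp [F]
  have h0 := h (mem_borelOrbit_self (upperPart ρ)) F.det ?_
  · rw [hF] at h0
    have h1 : (Matrix.of fun s t : ArchIn ρ x y => upperPart ρ s.1 (ρ t.1)) = 1 := by
      ext s t
      rw [Matrix.of_apply, upperPart, Matrix.of_apply, Matrix.one_apply]
      congr 1
      rw [ρ.injective.eq_iff, Subtype.ext_iff, eq_iff_iff]
      refine ⟨fun g => g.2, fun g => ⟨?_, g⟩⟩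
      rw [← g]
      exact s.2.2.1
    rw [h1, Matrix.det_one] at h0
    exact one_ne_zero h0
  · rintro _ ⟨b, hb, rfl⟩
    rw [hF]
    have hbinv : ((b⁻¹ : GL (Fin N) ℂ) : Matrix (Fin N) (Fin N) ℂ).BlockTriangular id := by
      rw [Matrix.coe_units_inv]
      have : Invertible (b : Matrix (Fin N) (Fin N) ℂ) := b.invertible
      exact Matrix.blockTriangular_inv_of_blockTriangular hb
    rw [← det_mul_eq_zero_of_card_lt
      (Matrix.of fun (s : ArchIn ρ x y) (k : ArchIn π x y) => b.1 s.1 k.1)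
      (Matrix.of fun (k : ArchIn π x y) (t : ArchIn ρ x y) => (b⁻¹ : GL (Fin N) ℂ).1 (π k.1) (ρ t.1))
      (by rwa [card_archIn, card_archIn])]
    congr 1
    ext s t
    have hcol : ∀ l, (b.1 * upperPart π) s.1 l = ∑ k, if k < π k ∧ π k = l then b.1 s.1 k else 0 := by
      intro l
      rw [Matrix.mul_apply]
      refine Finset.sum_congr rfl fun k _ => ?_
      rw [upperPart, Matrix.of_apply, mul_ite, mul_one, mul_zero]
      congr 1
      rw [eq_iff_iff]
      constructor
      · rintro ⟨h1, h2⟩; exact ⟨by rw [h2]; exact h1, h2⟩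
      · rintro ⟨h1, h2⟩; exact ⟨by rw [← h2]; exact h1, h2⟩
    rw [Matrix.of_apply, Matrix.mul_apply, Matrix.mul_apply]
    simp only [hcol, Matrix.of_apply, Finset.sum_mul]
    rw [Finset.sum_comm]
    have hk : ∀ k : Fin N, ∑ l, (if k < π k ∧ π k = l then b.1 s.1 k else 0) *
        (b⁻¹ : GL (Fin N) ℂ).1 l (ρ t.1) =
        if k < π k then b.1 s.1 k * (b⁻¹ : GL (Fin N) ℂ).1 (π k) (ρ t.1) else 0 := by
      intro k
      rw [Finset.sum_eq_single (π k)]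
      · by_cases hkk : k < π k <;> simp [hkk]
      · intro l _ hl
        rw [if_neg fun g => hl g.2.symm, zero_mul]
      · simp
    simp only [hk]
    rw [← Finset.sum_subtype (Finset.univ.filter fun k : Fin N => x ≤ k.1 ∧ k.1 < (π k).1 ∧
      (π k).1 < y) (by simp)
      (fun k => b.1 s.1 k * (b⁻¹ : GL (Fin N) ℂ).1 (π k) (ρ t.1)), Finset.sum_filter]
    refine Finset.sum_congr rfl fun k _ => ?_
    have hs := s.2
    have ht := t.2
    by_cases hkk : k.1 < (π k).1
    · rw [if_pos (Fin.lt_def.2 hkk)]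
      split_ifs with hin
      · rfl
      -- An arch of `π` leaving `[x, y)` contributes nothing: one starting before `x` is killed by
      -- the triangularity of `b`, one ending at `y` or later by that of `b⁻¹`.
      · by_cases hxk : x ≤ k.1
        · have hlt : ρ t.1 < π k := by rw [Fin.lt_def]; omega
          rw [hbinv hlt, mul_zero]
        · have hlt : k < s.1 := by rw [Fin.lt_def]; omega
          rw [hb hlt, zero_mul]
    · rw [if_neg fun hin => hkk (Fin.lt_def.1 hin), if_neg fun hin => hkk hin.2.1]

/-! ### The order of orbit closures and its covering relation -/

theorem orbitGE_iff (hπ : Function.Involutive π) (hρ : Function.Involutive ρ) :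
    OrbitGE π ρ ↔ ∀ i j : Fin N, i < j → archRank ρ i j ≤ archRank π i j := by
  rw [forall_archRank_le_iff]
  exact ⟨intervalRank_le_of_subset_zariskiClosure, fun h =>
    ((moveChain_of_intervalRank_le hπ hρ h).borelOrbit_subset_closure hπ).trans
      (closure_subset_zariskiClosure _)⟩

theorem orbit_subset_closure_iff (hπ : Function.Involutive π) (hρ : Function.Involutive ρ) :
    borelOrbit (upperPart ρ) ⊆ closure (borelOrbit (upperPart π)) ↔
      ∀ i j : Fin N, i < j → archRank ρ i j ≤ archRank π i j := by
  refine ⟨fun h => (orbitGE_iff hπ hρ).1 (h.trans (closure_subset_zariskiClosure _)), fun h => ?_⟩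
  rw [forall_archRank_le_iff] at h
  exact (moveChain_of_intervalRank_le hπ hρ h).borelOrbit_subset_closure hπ

theorem orbitGE_iff_moveChain (hπ : Function.Involutive π) (hρ : Function.Involutive ρ) :
    OrbitGE π ρ ↔ MoveChain π ρ := by
  refine ⟨fun h => moveChain_of_intervalRank_le hπ hρ
    (intervalRank_le_of_subset_zariskiClosure h), fun h => ?_⟩
  exact (h.borelOrbit_subset_closure hπ).trans (closure_subset_zariskiClosure _)

theorem orbitGT_iff (hπ : Function.Involutive π) (hρ : Function.Involutive ρ) :
    OrbitGT π ρ ↔ MoveChain π ρ ∧ grade π + 4 ≤ grade ρ := by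
  unfold OrbitGT
  rw [orbitGE_iff_moveChain hπ hρ, orbitGE_iff_moveChain hρ hπ]
  constructor
  · rintro ⟨h1, h2⟩
    refine ⟨h1, (h1.eq_or_grade hπ).resolve_left ?_⟩
    rintro rfl
    exact h2 h1
  · rintro ⟨h1, h2⟩
    refine ⟨h1, fun h3 => ?_⟩
    rcases h3.eq_or_grade hρ with h | h
    · subst h; omega
    · omega

theorem orbitCovers_iff (hπ : Function.Involutive π) (hρ : Function.Involutive ρ) :
    OrbitCovers π ρ ↔ Move π ρ := by
  unfold OrbitCovers
  rw [orbitGT_iff hπ hρ]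
  constructor
  · rintro ⟨⟨h1, h2⟩, h3⟩
    cases h1 with
    | refl => omega
    | @step _ σ _ hσ hm hc =>
      have hg := grade_of_move hπ hσ hm
      rcases hc.eq_or_grade hσ with h | h
      · subst h; exact hm
      -- A nontrivial remaining chain would put `σ` strictly between `π` and `ρ`.
      · exact absurd ⟨(orbitGT_iff hπ hσ).2 ⟨.step hσ hm (.refl _), hg.ge⟩,
          (orbitGT_iff hσ hρ).2 ⟨hc, h⟩⟩ (h3 σ hσ)
  · intro hm
    have hg := grade_of_move hπ hρ hm
    refine ⟨⟨.step hρ hm (.refl _), hg.ge⟩, ?_⟩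
    rintro σ hσ ⟨h1, h2⟩
    have g1 := ((orbitGT_iff hπ hσ).1 h1).2
    have g2 := ((orbitGT_iff hσ hρ).1 h2).2
    omega

end

end OrbitPoset

open OrbitPoset in
theorem mainTheorem8 (N : ℕ) (π ρ : Equiv.Perm (Fin N))
    (hπ : Function.Involutive π) (hρ : Function.Involutive ρ) :
    (borelOrbit (upperPart ρ) ⊆ zariskiClosure (borelOrbit (upperPart π)) ↔
      ∀ i j : Fin N, i < j → archRank ρ i j ≤ archRank π i j) ∧
    (borelOrbit (upperPart ρ) ⊆ closure (borelOrbit (upperPart π)) ↔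
      ∀ i j : Fin N, i < j → archRank ρ i j ≤ archRank π i j) ∧
    (OrbitCovers π ρ ↔ Move π ρ) :=
  ⟨orbitGE_iff hπ hρ, orbit_subset_closure_iff hπ hρ, orbitCovers_iff hπ hρ⟩
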